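/- A linear forest is a graph whose connected components are all paths. Let $k \ge 2$ and let $F$ be a linear forest with exactly $k$ components, of orders (numbers of vertices) $v_1,\dots,v_k \ge 2$, not all equal to $3$. Put $s=\sum_{i=1}^k \lfloor v_i/2\rfloor$, and let $c=1$ if all $v_i$ are odd and $c=0$ otherwise. Let $\mathrm{ex}(n,F)$ be the maximum number of edges of an $n$-vertex simple graph that does not contain $F$ as a (not necessarily induced) subgraph. Then there is $N$, depending on $F$, such that for all $n \ge N$ $$\mathrm{ex}(n,F)=(s-1)(n-s+1)+\binom{s-1}{2}+c .$$ Moreover, for all $n \ge N$ the extremal graph is unique up to isomorphism: an $n$-vertex graph is $F$-free with $\mathrm{ex}(n,F)$ edges if and only if it is isomorphic to $G_F(n)$, the $n$-vertex graph consisting of $s-1$ universal vertices (each adjacent to all other vertices) and $n-s+1$ further vertices which span exactly one edge if all $v_i$ are odd and no edge otherwise. -/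

import Mathlib

namespace LinearForest

/-- `F` is a linear forest with `k` components of orders `v 0, …, v (k - 1)`: its connected
components can be listed, without repetition, so that the `i`-th one is a path on `v i` vertices. -/
def IsLinearForest {W : Type*} (F : SimpleGraph W) {k : ℕ} (v : Fin k → ℕ) : Prop :=
  ∃ e : Fin k ≃ F.ConnectedComponent,
    ∀ i, Nonempty ((e i).toSimpleGraph ≃g SimpleGraph.pathGraph (v i))

/-- The sum of `⌊v i / 2⌋` over all components. -/
def halfSum {k : ℕ} (v : Fin k → ℕ) : ℕ := ∑ i, v i / 2

/-- The graph on `n` vertices whose first `u = ∑ ⌊v i / 2⌋ - 1` vertices are universal; the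
remaining vertices span the single edge `{u, u + 1}` if every `v i` is odd, and are independent
otherwise. -/
def extremalGraph {k : ℕ} (v : Fin k → ℕ) (n : ℕ) : SimpleGraph (Fin n) where
  Adj x y := x ≠ y ∧
    (x.val < halfSum v - 1 ∨ y.val < halfSum v - 1 ∨
      ((∀ i, Odd (v i)) ∧
        ((x.val = halfSum v - 1 ∧ y.val = halfSum v) ∨
          (x.val = halfSum v ∧ y.val = halfSum v - 1))))
  symm := ⟨fun x y h => ⟨h.1.symm, by tauto⟩⟩
  loopless := ⟨fun _ h => h.1 rfl⟩

end LinearForest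

namespace LinearForest

open Finset SimpleGraph
open scoped Classical

universe u

variable {W : Type*} {F : SimpleGraph W} {k : ℕ} {v : Fin k → ℕ}
  {V : Type*} {G : SimpleGraph V}

/-! Write `s` for `halfSum v` and count edges as ordered pairs. In the extremal graph a path on `p`
vertices uses at least `p / 2` universal vertices, and the extra edge cannot help a path of odd
order, so `s - 1` universal vertices are one too few for `F`.

Conversely, let `G` be `F`-free with at least as many edges as that graph. The main tool is a
weighted Erdős–Gallai theorem, `exists_isPathList_of_lt_weight`. With `f w` the number of neighbours
of `w` in a fixed set, too many edges yield a vertex `w` starting a path on `q = s - f w` vertices,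
and also a path on `2 * q - 1` vertices. Suppose no `s - 1` vertices have abundant common
neighbours. Then, for any bounded `A`, deleting a further bounded set `B` leaves few edges, even
counting those to `A` (`exists_sparse_outside`), so linearly many edges go to `B`. Iterating,
bounded sets meet an ever larger multiple of `n` edges, against the linear bound
`adjCount_univ_le_of_free`. Hence there is a rich set `U` of `s - 1` vertices
(`exists_isRich_of_free`).

Paths alternating between `U` and its common neighbours fall one vertex of `U` short of `F`. Hence
anything outside `U` that saves one vertex for one component completes `F`
(`isContained_of_saving`). This makes vertices without neighbours in `U` a net loss of edges and
leaves at most the one exceptional edge among the others, so the edge count forces the extremal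
structure. Orders not all `3` matter in the odd case, where some order is then at least `5`; for
orders all `3` a whole matching outside `U` would be harmless. -/

/-- The list `l` runs through the vertices of a path of `G`. -/
structure IsPathList (G : SimpleGraph V) (l : List V) : Prop where
  nodup : l.Nodup
  chain : l.IsChain G.Adj

/-! ### Counting ordered adjacent pairs -/

/-- The number of ordered pairs in `A × B` that are adjacent in `G`. -/
noncomputable def adjCount (G : SimpleGraph V) (A B : Finset V) : ℕ :=
  ∑ a ∈ A, #{b ∈ B | G.Adj a b}

theorem adjCount_comm (G : SimpleGraph V) (A B : Finset V) :
    adjCount G A B = adjCount G B A := by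
  simp only [adjCount, card_filter]
  rw [sum_comm]
  simp only [G.adj_comm]

theorem adjCount_union_left {A A' : Finset V} (h : Disjoint A A') (B : Finset V) :
    adjCount G (A ∪ A') B = adjCount G A B + adjCount G A' B :=
  sum_union h

theorem adjCount_union_right (A : Finset V) {B B' : Finset V} (h : Disjoint B B') :
    adjCount G A (B ∪ B') = adjCount G A B + adjCount G A B' := by
  rw [adjCount_comm, adjCount_union_left h, adjCount_comm G B, adjCount_comm G B']

theorem adjCount_union_self {A B : Finset V} (h : Disjoint A B) :
    adjCount G (A ∪ B) (A ∪ B) = adjCount G A A + adjCount G B B + 2 * adjCount G A B := by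
  rw [adjCount_union_left h, adjCount_union_right _ h, adjCount_union_right _ h,
    adjCount_comm G B A]
  ring

theorem adjCount_le_mul (A B : Finset V) : adjCount G A B ≤ #A * #B := by
  rw [← smul_eq_mul]
  exact sum_le_card_nsmul _ _ _ fun a _ => card_filter_le _ _

theorem adjCount_self_le (A : Finset V) : adjCount G A A ≤ #A * (#A - 1) := by
  rw [← smul_eq_mul]
  refine sum_le_card_nsmul _ _ _ fun a ha => ?_
  rw [← card_erase_of_mem ha]
  refine card_le_card fun b hb => ?_
  simp only [mem_filter, mem_erase] at hb ⊢
  exact ⟨hb.2.ne', hb.1⟩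

theorem adjCount_singleton (a : V) (B : Finset V) :
    adjCount G {a} B = #{b ∈ B | G.Adj a b} := by
  simp [adjCount]

theorem adjCount_self_erase {D : Finset V} {w : V} (hw : w ∈ D) :
    adjCount G D D = adjCount G (D.erase w) (D.erase w) + 2 * #{b ∈ D | G.Adj w b} := by
  have h : Disjoint (D.erase w) {w} := by simp
  have hD : D.erase w ∪ {w} = D := by
    rw [union_comm, ← insert_eq, insert_erase hw]
  have h1 : #{b ∈ D | G.Adj w b} = #{b ∈ D.erase w | G.Adj w b} := by
    congr 1
    ext b
    simp only [mem_filter, mem_erase]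
    exact ⟨fun hb => ⟨⟨hb.2.ne', hb.1⟩, hb.2⟩, fun hb => ⟨hb.1.2, hb.2⟩⟩
  conv_lhs => rw [← hD]
  rw [adjCount_union_self h, adjCount_comm G (D.erase w) {w}, adjCount_singleton,
    adjCount_singleton, h1]
  simp [filter_singleton]

/-! ### Operations on paths and rotation -/

namespace IsPathList

theorem reverse {l : List V} (h : IsPathList G l) : IsPathList G l.reverse :=
  ⟨List.nodup_reverse.2 h.nodup, by
    rw [List.isChain_reverse]
    exact h.chain.imp fun a b hab => hab.symm⟩

theorem take {l : List V} (h : IsPathList G l) (n : ℕ) : IsPathList G (l.take n) :=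
  ⟨h.nodup.sublist (List.take_sublist _ _), h.chain.take n⟩

theorem singleton (a : V) : IsPathList G [a] := ⟨by simp, by simp⟩

theorem cons {a : V} {l : List V} (h : IsPathList G l) (ha : a ∉ l)
    (hadj : ∀ b ∈ l.head?, G.Adj a b) : IsPathList G (a :: l) :=
  ⟨List.nodup_cons.2 ⟨ha, h.nodup⟩, h.chain.cons hadj⟩

theorem append {l l' : List V} (h : IsPathList G l) (h' : IsPathList G l') (hd : l.Disjoint l')
    (hadj : ∀ a ∈ l.getLast?, ∀ b ∈ l'.head?, G.Adj a b) : IsPathList G (l ++ l') :=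
  ⟨List.nodup_append'.2 ⟨h.nodup, h'.nodup, hd⟩, h.chain.append h'.chain hadj⟩

theorem left_of_append {l l' : List V} (h : IsPathList G (l ++ l')) : IsPathList G l :=
  ⟨(List.nodup_append'.1 h.nodup).1, h.chain.left_of_append⟩

theorem right_of_append {l l' : List V} (h : IsPathList G (l ++ l')) : IsPathList G l' :=
  ⟨(List.nodup_append'.1 h.nodup).2.1, h.chain.right_of_append⟩

theorem disjoint_of_append {l l' : List V} (h : IsPathList G (l ++ l')) : l.Disjoint l' :=
  (List.nodup_append'.1 h.nodup).2.2

/-- A vertex attached to a cycle gives a path through the whole cycle. -/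
theorem of_cycle {a b : List V} {x y : V} (hc : IsPathList G (a ++ y :: b))
    (hcyc : ∀ u ∈ (a ++ y :: b).getLast?, ∀ v ∈ (a ++ y :: b).head?, G.Adj u v)
    (hxy : G.Adj x y) (hx : x ∉ a ++ y :: b) : IsPathList G (x :: ((y :: b) ++ a)) := by
  refine cons (hc.right_of_append.append hc.left_of_append hc.disjoint_of_append.symm ?_) ?_ ?_
  · intro u hu v hv
    refine hcyc u ?_ v ?_
    · rw [List.getLast?_append]
      rw [Option.mem_def] at hu
      rw [hu]; simp
    · cases a with
      | nil => simp at hv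
      | cons c a => simpa using hv
  · simp only [List.mem_append] at hx ⊢
    tauto
  · simpa using hxy

/-- A path that cannot be extended at its ends closes up to a cycle on the same vertices. The cycle
misses a vertex of `D`, so connectedness gives an edge leaving it, and opening the cycle there gains
a vertex. -/
theorem exists_longer {D : Finset V} {d : ℕ}
    (hconn : ∀ T ⊆ D, T.Nonempty → (D \ T).Nonempty → ∃ x ∈ T, ∃ y ∈ D \ T, G.Adj x y)
    (hdeg : ∀ w ∈ D, d ≤ #{b ∈ D | G.Adj w b}) (hcard : 2 * d + 1 ≤ #D)
    {l : List V} (hl : IsPathList G l) (hlD : ∀ x ∈ l, x ∈ D) (hne : l ≠ [])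
    (hlen : l.length ≤ 2 * d) :
    ∃ l', IsPathList G l' ∧ (∀ x ∈ l', x ∈ D) ∧ l'.length = l.length + 1 := by
  have hpos : 0 < l.length := List.length_pos_iff.2 hne
  by_cases h0 : ∃ x ∈ D, x ∉ l ∧ G.Adj l[0] x
  · obtain ⟨x, hxD, hxl, hx⟩ := h0
    refine ⟨x :: l, hl.cons hxl ?_, by simpa using ⟨hxD, hlD⟩, by simp⟩
    intro b hb
    rw [List.head?_eq_getElem?, List.getElem?_eq_getElem hpos] at hb
    simp only [Option.mem_def, Option.some.injEq] at hb
    rw [← hb]; exact hx.symm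
  by_cases h1 : ∃ x ∈ D, x ∉ l ∧ G.Adj l[l.length - 1] x
  · obtain ⟨x, hxD, hxl, hx⟩ := h1
    refine ⟨l ++ [x], hl.append (singleton x) (by simpa using hxl) ?_, ?_, by simp⟩
    · intro a ha b hb
      rw [List.getLast?_eq_getElem?, List.getElem?_eq_getElem (by omega)] at ha
      simp only [Option.mem_def, Option.some.injEq, List.head?_cons] at ha hb
      rw [← ha, ← hb]; exact hx
    · intro y hy
      simp only [List.mem_append, List.mem_singleton] at hy
      rcases hy with hy | rfl
      exacts [hlD y hy, hxD]
  push Not at h0 h1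
  -- Both ends have at least `d` neighbours, all on the path, and there are fewer than `2 * d`
  -- positions `i`: pigeonhole.
  obtain ⟨i, hi, hi0, hi1⟩ : ∃ i, ∃ hi : i + 1 < l.length, G.Adj l[0] l[i + 1] ∧
      G.Adj l[l.length - 1] l[i] := by
    by_contra hcon
    push Not at hcon
    set I : Finset ℕ := {i ∈ range (l.length - 1) | ∃ hi : i + 1 < l.length, G.Adj l[0] l[i + 1]}
    set J : Finset ℕ := {i ∈ range (l.length - 1) | ∃ hi : i + 1 < l.length,
      G.Adj l[l.length - 1] l[i]}
    have hIJ : Disjoint I J := by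
      rw [Finset.disjoint_left]
      intro i hi hj
      simp only [I, J, mem_filter] at hi hj
      obtain ⟨_, h, hi⟩ := hi
      obtain ⟨_, h', hj⟩ := hj
      exact hcon i h hi hj
    have hI : d ≤ #I := by
      refine (hdeg l[0] (hlD _ (List.getElem_mem _))).trans ?_
      refine (card_le_card (t := I.image fun i => l.getD (i + 1) l[0]) ?_).trans card_image_le
      intro x hx
      simp only [mem_filter] at hx
      have hxl : x ∈ l := by
        by_contra hxl
        exact h0 x hx.1 hxl hx.2
      obtain ⟨j, hj, rfl⟩ := List.getElem_of_mem hxl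
      have hj0 : j ≠ 0 := by
        rintro rfl
        exact hx.2.ne rfl
      obtain ⟨j, rfl⟩ := Nat.exists_eq_succ_of_ne_zero hj0
      simp only [mem_image, I, mem_filter, Finset.mem_range]
      exact ⟨j, ⟨by omega, hj, hx.2⟩, by simp [hj]⟩
    have hJ : d ≤ #J := by
      refine (hdeg l[l.length - 1] (hlD _ (List.getElem_mem _))).trans ?_
      refine (card_le_card (t := J.image fun i => l.getD i l[0]) ?_).trans card_image_le
      intro x hx
      simp only [mem_filter] at hx
      have hxl : x ∈ l := by
        by_contra hxl
        exact h1 x hx.1 hxl hx.2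
      obtain ⟨j, hj, rfl⟩ := List.getElem_of_mem hxl
      have hj0 : j ≠ l.length - 1 := by
        rintro rfl
        exact hx.2.ne rfl
      simp only [mem_image, J, mem_filter, Finset.mem_range]
      exact ⟨j, ⟨by omega, by omega, hx.2⟩, by simp [hj]⟩
    have := card_union_of_disjoint hIJ
    have h2 : #(I ∪ J) ≤ l.length - 1 := by
      rw [← card_range (l.length - 1)]
      exact card_le_card (union_subset (filter_subset _ _) (filter_subset _ _))
    omega
  -- Reversing the initial segment makes the ends `l[i]` and `l[l.length - 1]`, which are adjacent.
  set c := (l.take (i + 1)).reverse ++ l.drop (i + 1) with hcdef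
  have hsplit : IsPathList G (l.take (i + 1) ++ l.drop (i + 1)) := by
    rwa [List.take_append_drop]
  have hc : IsPathList G c := by
    refine hsplit.left_of_append.reverse.append hsplit.right_of_append ?_ ?_
    · intro x hx hx'
      exact hsplit.disjoint_of_append (List.mem_reverse.1 hx) hx'
    · intro a ha b hb
      rw [List.getLast?_reverse, List.head?_take, if_neg (by omega), List.head?_eq_getElem?,
        List.getElem?_eq_getElem hpos] at ha
      rw [List.head?_drop, List.getElem?_eq_getElem hi] at hb
      simp only [Option.mem_def, Option.some.injEq] at ha hb
      rw [← ha, ← hb]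
      exact hi0
  have hmem : ∀ x, x ∈ c ↔ x ∈ l := by
    intro x
    rw [hcdef, List.mem_append, List.mem_reverse, ← List.mem_append, List.take_append_drop]
  have hlenc : c.length = l.length := by
    simp [hcdef]; omega
  have hcyc : ∀ u ∈ c.getLast?, ∀ v ∈ c.head?, G.Adj u v := by
    intro u hu v hv
    have hu' : u = l[l.length - 1] := by
      rw [hcdef, List.getLast?_append, List.getLast?_drop, if_neg (by omega),
        List.getLast?_eq_getElem?, List.getElem?_eq_getElem (by omega)] at hu
      simpa [eq_comm] using hu
    have hv' : v = l[i] := by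
      rw [hcdef, List.head?_append, List.head?_reverse, List.getLast?_take, if_neg (by omega)] at hv
      simp only [add_tsub_cancel_right] at hv
      rw [List.getElem?_eq_getElem (by omega)] at hv
      simpa [eq_comm] using hv
    rw [hu', hv']
    exact hi1
  obtain ⟨y, hy, x, hx, hyx⟩ := hconn l.toFinset (by intro x hx; exact hlD x (by simpa using hx))
    ⟨l[0], by simp⟩ (by
      rw [← card_pos, card_sdiff_of_subset (by intro x hx; exact hlD x (by simpa using hx)),
        List.toFinset_card_of_nodup hl.nodup]
      omega)
  rw [List.mem_toFinset, ← hmem] at hy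
  simp only [mem_sdiff, List.mem_toFinset] at hx
  obtain ⟨a, b, hab⟩ := List.append_of_mem hy
  rw [hab] at hc hcyc
  have hxc : x ∉ a ++ y :: b := by rw [← hab, hmem]; exact hx.2
  refine ⟨_, hc.of_cycle hcyc hyx.symm hxc, ?_, ?_⟩
  · intro z hz
    have : z = x ∨ z ∈ c := by
      rw [hab]
      simp only [List.mem_cons, List.mem_append] at hz ⊢
      tauto
    rcases this with rfl | h
    exacts [hx.1, hlD z ((hmem z).1 h)]
  · rw [← hlenc, hab]
    simp
    omega

end IsPathList

/-! ### Paths from degrees and from edge density -/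

/-- A connected graph with minimum degree at least `d` and at least `2 d + 1` vertices contains a
path on `2 d + 1` vertices. -/
theorem exists_isPathList_of_le_degree {D : Finset V} {d : ℕ}
    (hconn : ∀ T ⊆ D, T.Nonempty → (D \ T).Nonempty → ∃ x ∈ T, ∃ y ∈ D \ T, G.Adj x y)
    (hdeg : ∀ w ∈ D, d ≤ #{b ∈ D | G.Adj w b}) (hcard : 2 * d + 1 ≤ #D) :
    ∃ l, IsPathList G l ∧ (∀ x ∈ l, x ∈ D) ∧ l.length = 2 * d + 1 := by
  have key : ∀ p, p ≤ 2 * d → ∃ l, IsPathList G l ∧ (∀ x ∈ l, x ∈ D) ∧ l.length = p + 1 := by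
    intro p
    induction p with
    | zero =>
      intro _
      obtain ⟨w, hw⟩ : D.Nonempty := by rw [← card_pos]; omega
      exact ⟨[w], .singleton w, by simpa using hw, rfl⟩
    | succ p ih =>
      intro hp
      obtain ⟨l, hl, hlD, hlen⟩ := ih (by omega)
      obtain ⟨l', h1, h2, h3⟩ := hl.exists_longer hconn hdeg hcard hlD
        (by rintro rfl; simp at hlen) (by omega)
      exact ⟨l', h1, h2, by omega⟩
  exact key _ le_rfl

/-- If all degrees are at least `d`, then every vertex starts a path on `d + 1` vertices. -/
theorem exists_isPathList_head {D : Finset V} {d : ℕ}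
    (hdeg : ∀ w ∈ D, d ≤ #{b ∈ D | G.Adj w b}) {w : V} (hw : w ∈ D) :
    ∃ l, IsPathList G (w :: l) ∧ (∀ x ∈ w :: l, x ∈ D) ∧ l.length = d := by
  -- The path is grown backwards from `w` and reversed at the end.
  have key : ∀ p, p ≤ d → ∃ x l, IsPathList G (x :: l) ∧ (∀ y ∈ x :: l, y ∈ D) ∧ l.length = p ∧
      (x :: l).getLast? = some w := by
    intro p
    induction p with
    | zero => exact fun _ => ⟨w, [], .singleton w, by simpa using hw, rfl, rfl⟩
    | succ p ih =>
      intro hp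
      obtain ⟨x, l, hl, hlD, hlen, hlast⟩ := ih (by omega)
      obtain ⟨y, hy, hyl⟩ : ∃ y ∈ ({b ∈ D | G.Adj x b} : Finset V), y ∉ l.toFinset := by
        refine Finset.exists_mem_notMem_of_card_lt_card ?_
        have := hdeg x (hlD x (by simp))
        have := l.toFinset_card_le
        omega
      simp only [mem_filter, List.mem_toFinset] at hy hyl
      refine ⟨y, x :: l, hl.cons ?_ (by simpa using hy.2.symm), ?_, by simp [hlen], ?_⟩
      · simp only [List.mem_cons, not_or]
        exact ⟨hy.2.ne', hyl⟩
      · intro z hz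
        rcases List.mem_cons.1 hz with rfl | hz
        exacts [hy.1, hlD z hz]
      · rw [List.getLast?_cons_cons, hlast]
  obtain ⟨x, l, hl, hlD, hlen, hlast⟩ := key d le_rfl
  have hh : ((x :: l).reverse).head? = some w := by rw [List.head?_reverse, hlast]
  obtain ⟨l', hl'⟩ : ∃ l', (x :: l).reverse = w :: l' := by
    cases h : (x :: l).reverse with
    | nil => simp at h
    | cons a t => rw [h] at hh; simp at hh; exact ⟨t, by rw [hh]⟩
  have h2 := hl.reverse
  refine ⟨l', hl' ▸ h2, ?_, ?_⟩
  · intro z hz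
    rw [← hl', List.mem_reverse] at hz
    exact hlD z hz
  · have := congrArg List.length hl'
    simp at this
    omega

/-- A weighted form of the theorem of Erdős and Gallai on paths with an odd number of vertices. -/
theorem exists_isPathList_of_lt_weight (f : V → ℕ) {s : ℕ} (D : Finset V)
    (hf : ∀ w ∈ D, f w + 2 ≤ s)
    (hlt : 2 * s * #D < adjCount G D D + 2 * ∑ w ∈ D, f w + 3 * #D) :
    ∃ w ∈ D, (∃ l, IsPathList G (w :: l) ∧ (∀ x ∈ w :: l, x ∈ D) ∧ l.length + 1 + f w = s) ∧
      ∃ l, IsPathList G l ∧ (∀ x ∈ l, x ∈ D) ∧ l.length + 1 + 2 * f w = 2 * s := by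
  induction D using Finset.strongInduction with
  | H D ih =>
  by_cases hsub : ∃ T ⊂ D, 2 * s * #T < adjCount G T T + 2 * ∑ w ∈ T, f w + 3 * #T
  · obtain ⟨T, hT, hlt'⟩ := hsub
    obtain ⟨w, hw, ⟨l, h1, h2, h3⟩, l', h1', h2', h3'⟩ := ih T hT (fun w hw => hf w (hT.1 hw)) hlt'
    exact ⟨w, hT.1 hw, ⟨l, h1, fun x hx => hT.1 (h2 x hx), h3⟩,
      l', h1', fun x hx => hT.1 (h2' x hx), h3'⟩
  -- In a minimal `D`, deleting a vertex or splitting off a part without outgoing edges would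
  -- preserve the inequality. This gives the degree bound, weakest where `f` is maximal, and
  -- connectedness.
  push Not at hsub
  have hne : D.Nonempty := by
    rw [nonempty_iff_ne_empty]
    rintro rfl
    simp [adjCount] at hlt
  obtain ⟨w, hw, hmax⟩ := exists_max_image D f hne
  have hfw := hf w hw
  obtain ⟨d, hd⟩ : ∃ d, d + 1 + f w = s := ⟨s - 1 - f w, by omega⟩
  have hdeg : ∀ x ∈ D, d ≤ #{b ∈ D | G.Adj x b} := by
    intro x hx
    have h1 := hsub _ (erase_ssubset hx)
    have h2 := adjCount_self_erase (G := G) hx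
    have h3 := sum_erase_add D f hx
    have h4 := card_erase_add_one hx
    have h5 := hmax x hx
    rw [← h4, mul_add] at hlt
    omega
  have hconn : ∀ T ⊆ D, T.Nonempty → (D \ T).Nonempty →
      ∃ x ∈ T, ∃ y ∈ D \ T, G.Adj x y := by
    intro T hT hTne hTne'
    by_contra hcon
    push Not at hcon
    have h0 : adjCount G T (D \ T) = 0 :=
      sum_eq_zero fun x hx => by
        rw [card_eq_zero, filter_eq_empty_iff]
        exact fun y hy => hcon x hx y hy
    have h1 := hsub T (by
      refine hT.ssubset_of_ne ?_
      rintro rfl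
      simp at hTne')
    have h2 := hsub (D \ T) (sdiff_ssubset hT hTne)
    have h3 := adjCount_union_self (G := G) (disjoint_sdiff (s := T) (t := D))
    have h4 := sum_sdiff (f := f) hT
    have h5 := card_sdiff_add_card_eq_card hT
    rw [union_sdiff_of_subset hT] at h3
    rw [← h5, mul_add] at hlt
    omega
  -- With at most `2 * d` vertices, the right side of `hlt` is at most `#D * (2 * d - 1 + 2 * f w +
  -- 3) = 2 * s * #D`.
  have hcard : 2 * d + 1 ≤ #D := by
    have h1 := adjCount_self_le (G := G) D
    have h2 : ∑ x ∈ D, f x ≤ #D * f w := by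
      rw [← smul_eq_mul]
      exact sum_le_card_nsmul _ _ _ hmax
    have h3 : 0 < #D := card_pos.2 hne
    by_contra hcon
    obtain ⟨e, he⟩ : ∃ e, #D = e + 1 := ⟨#D - 1, by omega⟩
    have h4 : e + 1 ≤ 2 * d := by omega
    rw [he] at h1 h2 hlt
    simp only [add_tsub_cancel_right] at h1
    nlinarith
  refine ⟨w, hw, ?_, ?_⟩
  · obtain ⟨l, h1, h2, h3⟩ := exists_isPathList_head hdeg hw
    exact ⟨l, h1, h2, by omega⟩
  · obtain ⟨l, h1, h2, h3⟩ := exists_isPathList_of_le_degree hconn hdeg hcard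
    exact ⟨l, h1, h2, by omega⟩

/-! ### Embedding a linear forest path by path -/

section Containment

theorem isContained_of_isPathList (hF : IsLinearForest F v) (L : Fin k → List V)
    (hL : ∀ i, IsPathList G (L i)) (hlen : ∀ i, (L i).length = v i)
    (hdisj : ∀ i j, i ≠ j → (L i).Disjoint (L j)) : F ⊑ G := by
  obtain ⟨e, hφ⟩ := hF
  have φ := fun i => (hφ i).some
  let g : ∀ i, (e i) → V := fun i x => (L i)[(φ i x).val]'(by rw [hlen]; exact (φ i x).isLt)
  have hmem : ∀ w, w ∈ (e (e.symm (F.connectedComponentMk w))) := by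
    intro w
    rw [Equiv.apply_symm_apply]
    exact ConnectedComponent.connectedComponentMk_mem
  let f : W → V := fun w => g _ ⟨w, hmem w⟩
  have hf : ∀ w i (hw : w ∈ e i), f w = g i ⟨w, hw⟩ := by
    intro w i hw
    obtain rfl : i = e.symm (F.connectedComponentMk w) := by
      rw [Equiv.eq_symm_apply]
      exact (ConnectedComponent.mem_supp_iff _ _ |>.1 hw).symm
    rfl
  have hgmem : ∀ i x, g i x ∈ L i := fun i x => List.getElem_mem _
  refine ⟨⟨⟨f, ?_⟩, ?_⟩⟩
  · intro a b hab
    set i := e.symm (F.connectedComponentMk a) with hi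
    have ha : a ∈ e i := hmem a
    have hb : b ∈ e i := by
      rw [hi, Equiv.apply_symm_apply, ConnectedComponent.connectedComponentMk_eq_of_adj hab]
      exact ConnectedComponent.connectedComponentMk_mem
    rw [hf a i ha, hf b i hb]
    have h1 : (pathGraph (v i)).Adj (φ i ⟨a, ha⟩) (φ i ⟨b, hb⟩) := by
      rw [(φ i).map_adj_iff]
      exact hab
    have hch := List.isChain_iff_getElem.1 (hL i).chain
    rw [pathGraph_adj] at h1
    have hva := (φ i ⟨a, ha⟩).isLt
    have hvb := (φ i ⟨b, hb⟩).isLt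
    rcases h1 with h1 | h1
    · have h2 := hch (φ i ⟨a, ha⟩).val (by rw [hlen]; omega)
      simp only [h1] at h2
      exact h2
    · have h2 := hch (φ i ⟨b, hb⟩).val (by rw [hlen]; omega)
      simp only [h1] at h2
      exact h2.symm
  · intro a b hab
    change f a = f b at hab
    by_cases hij : e.symm (F.connectedComponentMk a) = e.symm (F.connectedComponentMk b)
    · have hb : b ∈ e (e.symm (F.connectedComponentMk a)) := by rw [hij]; exact hmem b
      rw [hf a _ (hmem a), hf b _ hb] at hab
      have h1 := (hL _).nodup.getElem_inj_iff.1 hab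
      have h2 := (φ _).injective (Fin.ext h1)
      simpa using h2
    · exact absurd hab fun h => hdisj _ _ hij (hgmem _ ⟨a, hmem a⟩) (by
        change f a ∈ _
        rw [h]
        exact hgmem _ ⟨b, hmem b⟩)

theorem exists_isPathList_of_isContained (hF : IsLinearForest F v) (h : F ⊑ G) :
    ∃ L : Fin k → List V, (∀ i, IsPathList G (L i)) ∧ (∀ i, (L i).length = v i) ∧
      ∀ i j, i ≠ j → (L i).Disjoint (L j) := by
  obtain ⟨e, hφ⟩ := hF
  have φ := fun i => (hφ i).some
  obtain ⟨c⟩ := h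
  refine ⟨fun i => List.ofFn fun j => c ((φ i).symm j).1, fun i => ⟨?_, ?_⟩, by simp, ?_⟩
  · rw [List.nodup_ofFn]
    exact c.injective.comp (Subtype.val_injective.comp (φ i).symm.injective)
  · rw [List.isChain_iff_getElem]
    intro j hj
    simp only [List.getElem_ofFn]
    refine c.toHom.map_adj ?_
    have h1 : (pathGraph (v i)).Adj ⟨j, by simp at hj; omega⟩ ⟨j + 1, by simpa using hj⟩ := by
      rw [pathGraph_adj]
      exact Or.inl rfl
    exact (φ i).symm.map_adj_iff.2 h1
  · intro i j hij x hx hy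
    simp only [List.mem_ofFn] at hx hy
    obtain ⟨a, rfl⟩ := hx
    obtain ⟨b, hb⟩ := hy
    have h1 := c.injective hb
    refine hij (e.injective ?_)
    have ha' := ((φ i).symm a).2
    have hb' := ((φ j).symm b).2
    rw [h1] at hb'
    exact (ConnectedComponent.mem_supp_iff _ _ |>.1 ha').symm.trans
      (ConnectedComponent.mem_supp_iff _ _ |>.1 hb')

/-- Disjoint paths can be found one after the other if the `i`-th one can be chosen to avoid any
bounded set of vertices that does not meet the set `R i` reserved for it. -/
theorem isContained_of_reserved (hF : IsLinearForest F v) {R : Fin k → Finset V} {M : ℕ}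
    (hR : ∀ i j, i ≠ j → Disjoint (R i) (R j))
    (hM : ∑ i, v i + #(univ.biUnion R) ≤ M)
    (h : ∀ i Z, #Z ≤ M → Disjoint Z (R i) →
      ∃ l, IsPathList G l ∧ v i ≤ l.length ∧ ∀ x ∈ l, x ∉ Z) : F ⊑ G := by
  have key : ∀ I : Finset (Fin k), ∃ L : Fin k → List V,
      (∀ i ∈ I, IsPathList G (L i) ∧ (L i).length = v i ∧ ∀ j, j ≠ i → ∀ x ∈ L i, x ∉ R j) ∧
      ∀ i ∈ I, ∀ j ∈ I, i ≠ j → (L i).Disjoint (L j) := by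
    intro I
    induction I using Finset.induction_on with
    | empty => exact ⟨fun _ => [], by simp, by simp⟩
    | insert i I hi ih =>
      obtain ⟨L, hL, hd⟩ := ih
      set Z : Finset V := I.biUnion (fun j => (L j).toFinset) ∪ (univ.erase i).biUnion R with hZ
      have hZc : #Z ≤ M := by
        refine le_trans ((card_union_le _ _).trans (add_le_add ?_ ?_)) hM
        · refine card_biUnion_le.trans ((sum_le_sum fun j hj => ?_).trans
            (sum_le_sum_of_subset (subset_univ I)))
          exact (L j).toFinset_card_le.trans (hL j hj).2.1.le
        · exact card_le_card (biUnion_subset_biUnion_of_subset_left _ (subset_univ _))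
      have hZR : Disjoint Z (R i) := by
        rw [hZ, disjoint_union_left, disjoint_biUnion_left, disjoint_biUnion_left]
        refine ⟨fun j hj => ?_, fun j hj => hR _ _ (ne_of_mem_erase hj)⟩
        rw [Finset.disjoint_left]
        intro x hx
        exact (hL j hj).2.2 i (by rintro rfl; exact hi hj) x (List.mem_toFinset.1 hx)
      obtain ⟨l, hl, hlen, hlZ⟩ := h i Z hZc hZR
      have hlZ' : ∀ x ∈ l.take (v i), x ∉ Z := fun x hx => hlZ x (List.mem_of_mem_take hx)
      have hne : ∀ j ∈ I, j ≠ i := by rintro j hj rfl; exact hi hj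
      have hdl : ∀ j ∈ I, (l.take (v i)).Disjoint (L j) := by
        intro j hj x hx hx'
        refine hlZ' x hx ?_
        rw [hZ]
        exact mem_union_left _ (mem_biUnion.2 ⟨j, hj, List.mem_toFinset.2 hx'⟩)
      refine ⟨Function.update L i (l.take (v i)), ?_, ?_⟩
      · intro j hj
        rcases mem_insert.1 hj with rfl | hj
        · rw [Function.update_self]
          refine ⟨hl.take _, by simpa using hlen, fun j' hj' x hx hx' => hlZ' x hx ?_⟩
          rw [hZ]
          exact mem_union_right _ (mem_biUnion.2 ⟨j', by simpa using hj', hx'⟩)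
        · rw [Function.update_of_ne (hne j hj)]
          exact hL j hj
      · intro j hj j' hj' hjj'
        rcases mem_insert.1 hj with rfl | h1 <;> rcases mem_insert.1 hj' with rfl | h2
        · exact absurd rfl hjj'
        · rw [Function.update_self, Function.update_of_ne (hne j' h2)]
          exact hdl j' h2
        · rw [Function.update_self, Function.update_of_ne (hne j h1)]
          exact (hdl j h1).symm
        · rw [Function.update_of_ne (hne j h1), Function.update_of_ne (hne j' h2)]
          exact hd j h1 j' h2 hjj'
  obtain ⟨L, hL, hd⟩ := key univ
  exact isContained_of_isPathList hF L (fun i => (hL i (mem_univ i)).1)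
    (fun i => (hL i (mem_univ i)).2.1) fun i j => hd i (mem_univ i) j (mem_univ j)

end Containment

/-! ### Rich sets and alternating paths -/

theorem exists_pairwise_disjoint_subsets {ι : Type*} [Fintype ι] (S : Finset V) (t : ι → ℕ)
    (h : ∑ i, t i ≤ #S) :
    ∃ R : ι → Finset V, (∀ i, R i ⊆ S ∧ #(R i) = t i) ∧ ∀ i j, i ≠ j → Disjoint (R i) (R j) := by
  have key : ∀ I : Finset ι, ∑ i ∈ I, t i ≤ #S → ∃ R : ι → Finset V,
      (∀ i ∈ I, R i ⊆ S ∧ #(R i) = t i) ∧ ∀ i ∈ I, ∀ j ∈ I, i ≠ j → Disjoint (R i) (R j) := by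
    intro I
    induction I using Finset.induction_on with
    | empty => exact fun _ => ⟨fun _ => ∅, by simp, by simp⟩
    | insert i I hi ih =>
      intro hle
      rw [sum_insert hi] at hle
      obtain ⟨R, hR, hd⟩ := ih (by omega)
      have hcard : #(I.biUnion R) ≤ ∑ i ∈ I, t i :=
        card_biUnion_le.trans (sum_le_sum fun j hj => (hR j hj).2.le)
      have hsub : I.biUnion R ⊆ S := biUnion_subset.2 fun j hj => (hR j hj).1
      obtain ⟨T, hT, hTc⟩ := exists_subset_card_eq (s := S \ I.biUnion R) (n := t i) (by
        rw [card_sdiff_of_subset hsub]; omega)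
      have hne : ∀ j ∈ I, j ≠ i := by rintro j hj rfl; exact hi hj
      have hdT : ∀ j ∈ I, Disjoint T (R j) := fun j hj =>
        disjoint_of_subset_left hT (disjoint_of_subset_right
          (subset_biUnion_of_mem R hj) sdiff_disjoint)
      refine ⟨Function.update R i T, ?_, ?_⟩
      · intro j hj
        rcases mem_insert.1 hj with rfl | hj
        · rw [Function.update_self]
          exact ⟨hT.trans sdiff_subset, hTc⟩
        · rw [Function.update_of_ne (hne j hj)]
          exact hR j hj
      · intro j hj j' hj' hjj'
        rcases mem_insert.1 hj with rfl | h1 <;> rcases mem_insert.1 hj' with rfl | h2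
        · exact absurd rfl hjj'
        · rw [Function.update_self, Function.update_of_ne (hne j' h2)]
          exact hdT j' h2
        · rw [Function.update_self, Function.update_of_ne (hne j h1)]
          exact (hdT j h1).symm
        · rw [Function.update_of_ne (hne j h1), Function.update_of_ne (hne j' h2)]
          exact hd j h1 j' h2 hjj'
  obtain ⟨R, hR, hd⟩ := key univ h
  exact ⟨R, fun i => hR i (mem_univ i), fun i j => hd i (mem_univ i) j (mem_univ j)⟩

/-- Outside of any set of at most `M` vertices there is a path on `q` vertices whose first vertex is
adjacent to all vertices of `R`. -/
def IsRich (G : SimpleGraph V) (M q : ℕ) (R : Finset V) : Prop :=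
  ∀ Z : Finset V, #Z ≤ M → ∃ w l, IsPathList G (w :: l) ∧ l.length + 1 = q ∧
    (∀ x ∈ w :: l, x ∉ Z) ∧ ∀ x ∈ R, G.Adj w x

theorem IsRich.subset {M q : ℕ} {R R' : Finset V} (h : IsRich G M q R) (hR : R' ⊆ R) :
    IsRich G M q R' := fun Z hZ => by
  obtain ⟨w, l, h1, h2, h3, h4⟩ := h Z hZ
  exact ⟨w, l, h1, h2, h3, fun x hx => h4 x (hR hx)⟩

/-- A path starting at a neighbour of a vertex of `R` can be extended so that it passes through all
of `R`. -/
theorem IsRich.exists_extension {M q : ℕ} {R : Finset V} (hR : IsRich G M q R) {u : V}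
    (hu : u ∈ R) {Q : List V} (hQ : IsPathList G Q) (hadj : ∀ b ∈ Q.head?, G.Adj u b)
    (hQR : ∀ x ∈ Q, x ∉ R) {Z : Finset V} (hQZ : ∀ x ∈ Q, x ∉ Z) (hZR : Disjoint Z R)
    (hM : #Z + 2 * #R + Q.length ≤ M) :
    ∃ x ∈ R, ∃ l, IsPathList G (x :: l) ∧ l.length + 2 = 2 * #R + Q.length ∧
      ∀ z ∈ x :: l, z ∉ Z := by
  induction hn : #R generalizing R Z with
  | zero => simp [card_eq_zero.1 hn] at hu
  | succ n ih =>
    by_cases hR1 : ∃ x ∈ R, x ≠ u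
    · obtain ⟨x, hx, hxu⟩ := hR1
      have hce := card_erase_add_one hx
      have hxZ : x ∉ Z := fun h => Finset.disjoint_left.1 hZR h hx
      have hci := card_insert_of_notMem hxZ
      obtain ⟨x', hx', l, h1, h2, h3⟩ := ih (R := R.erase x) (Z := insert x Z)
        (hR.subset (erase_subset _ _)) (mem_erase.2 ⟨hxu.symm, hu⟩)
        (fun z hz h => hQR z hz (mem_of_mem_erase h))
        (fun z hz h => by
          rcases mem_insert.1 h with rfl | h
          exacts [hQR z hz hx, hQZ z hz h])
        (by
          rw [disjoint_insert_left]
          exact ⟨by simp, disjoint_of_subset_right (erase_subset _ _) hZR⟩)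
        (by omega) (by omega)
      -- Only the first vertex of the path is needed, to link `x` to `x'`.
      obtain ⟨y, m, g1, g2, g3, g4⟩ := hR (Z ∪ (x' :: l).toFinset) (by
        refine (card_union_le _ _).trans ?_
        have := (x' :: l).toFinset_card_le
        simp only [List.length_cons] at this
        omega)
      have hyZ := g3 y (by simp)
      simp only [mem_union, List.mem_toFinset, not_or] at hyZ
      have hyx := g4 x hx
      refine ⟨x, hx, y :: x' :: l, (h1.cons hyZ.2 ?_).cons ?_ ?_, ?_, ?_⟩
      · simpa using g4 x' (mem_of_mem_erase hx')
      · intro h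
        rcases List.mem_cons.1 h with rfl | h
        · exact hyx.ne rfl
        · exact h3 x h (mem_insert_self _ _)
      · simpa using hyx.symm
      · simp only [List.length_cons]
        omega
      · intro z hz
        rcases List.mem_cons.1 hz with rfl | hz
        · exact hxZ
        rcases List.mem_cons.1 hz with rfl | hz
        · exact hyZ.1
        · exact fun h => h3 z hz (mem_insert_of_mem h)
    · push Not at hR1
      obtain rfl : R = {u} := eq_singleton_iff_unique_mem.2 ⟨hu, hR1⟩
      refine ⟨u, hu, Q, hQ.cons (fun h => hQR u h hu) hadj, ?_, ?_⟩
      · simp at hn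
        omega
      · intro z hz
        rcases List.mem_cons.1 hz with rfl | hz
        · exact fun h => Finset.disjoint_left.1 hZR h hu
        · exact hQZ z hz

/-- The path runs back through `P`, alternates between `R` and common neighbours of `R`, and leaves
through `u` into `Q`; the middle part has `2 * #R - 1` vertices. -/
theorem IsRich.exists_join {M q : ℕ} {R : Finset V} (hR : IsRich G M q R) {u : V}
    (hu : u ∈ R) {P Q : List V} (hP : IsPathList G P) (hQ : IsPathList G Q)
    (hPadj : ∀ a ∈ P.head?, ∀ x ∈ R, G.Adj a x) (hQadj : ∀ b ∈ Q.head?, G.Adj u b)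
    (hPQ : P.Disjoint Q) (hPR : ∀ x ∈ P, x ∉ R) (hQR : ∀ x ∈ Q, x ∉ R) {Z : Finset V}
    (hPZ : ∀ x ∈ P, x ∉ Z) (hQZ : ∀ x ∈ Q, x ∉ Z) (hZR : Disjoint Z R)
    (hM : #Z + P.length + 2 * #R + Q.length ≤ M) :
    ∃ l, IsPathList G l ∧ l.length + 1 = P.length + 2 * #R + Q.length ∧ ∀ z ∈ l, z ∉ Z := by
  obtain ⟨x, hx, l, h1, h2, h3⟩ := hR.exists_extension hu hQ hQadj hQR (Z := Z ∪ P.toFinset)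
    (fun z hz h => by
      rcases mem_union.1 h with h | h
      exacts [hQZ z hz h, hPQ (List.mem_toFinset.1 h) hz])
    (disjoint_union_left.2 ⟨hZR, Finset.disjoint_left.2 fun z hz =>
      hPR z (List.mem_toFinset.1 hz)⟩) (by
      have := card_union_le Z P.toFinset
      have := P.toFinset_card_le
      omega)
  refine ⟨P.reverse ++ x :: l, hP.reverse.append h1 ?_ ?_, ?_, ?_⟩
  · intro z hz hz'
    exact h3 z hz' (mem_union_right _ (by simpa using hz))
  · intro a ha b hb
    rw [List.getLast?_reverse] at ha
    simp only [List.head?_cons, Option.mem_def, Option.some.injEq] at hb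
    exact hPadj a ha b (hb ▸ hx)
  · simp only [List.length_append, List.length_reverse, List.length_cons]
    omega
  · intro z hz
    rcases List.mem_append.1 hz with hz | hz
    · exact hPZ z (List.mem_reverse.1 hz)
    · exact fun h => h3 z hz (mem_union_left _ h)

theorem IsRich.exists_isPathList {M q : ℕ} {R : Finset V} (hR : IsRich G M q R)
    (hne : R.Nonempty) {Z : Finset V} (hZR : Disjoint Z R) (hM : #Z + 2 * q + 2 * #R ≤ M) :
    ∃ l, IsPathList G l ∧ l.length + 1 = 2 * q + 2 * #R ∧ ∀ z ∈ l, z ∉ Z := by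
  obtain ⟨u, hu⟩ := hne
  have hc1 := card_union_le Z R
  obtain ⟨w, l, h1, h2, h3, h4⟩ := hR (Z ∪ R) (by omega)
  have hc2 := card_union_le (Z ∪ R) (w :: l).toFinset
  have hc3 := (w :: l).toFinset_card_le
  simp only [List.length_cons] at hc3
  obtain ⟨w', l', h1', h2', h3', h4'⟩ := hR (Z ∪ R ∪ (w :: l).toFinset) (by omega)
  simp only [mem_union, not_or, List.mem_toFinset] at h3 h3'
  obtain ⟨p, hp, hlen, hpZ⟩ := hR.exists_join hu h1' h1 (by simpa using h4')
    (by simpa using (h4 u hu).symm) (fun x hx hx' => (h3' x hx).2 hx')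
    (fun x hx => (h3' x hx).1.2) (fun x hx => (h3 x hx).2) (Z := Z)
    (fun x hx => (h3' x hx).1.1) (fun x hx => (h3 x hx).1) hZR
    (by simp only [List.length_cons]; omega)
  refine ⟨p, hp, ?_, hpZ⟩
  simp only [List.length_cons] at hlen
  omega

/-! ### Finding a rich set of `s - 1` vertices -/

theorem halfSum_le (v : Fin k → ℕ) : halfSum v ≤ ∑ i, v i :=
  sum_le_sum fun _ _ => Nat.div_le_self _ _

theorem le_halfSum (hv : ∀ i, 2 ≤ v i) : k ≤ halfSum v := by
  have : ∑ _i : Fin k, 1 ≤ halfSum v := sum_le_sum fun j _ => by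
    have := hv j
    omega
  simpa using this

theorem half_lt_halfSum (hk : 2 ≤ k) (hv : ∀ i, 2 ≤ v i) (i : Fin k) : v i / 2 < halfSum v := by
  obtain ⟨j, hj⟩ : ∃ j : Fin k, j ≠ i := by
    have : Nontrivial (Fin k) := Fin.nontrivial_iff_two_le.2 hk
    exact exists_ne i
  have h1 : ∑ x ∈ {i, j}, v x / 2 ≤ halfSum v := sum_le_sum_of_subset (subset_univ _)
  rw [sum_pair hj.symm] at h1
  have := hv j
  omega

theorem le_sum_orders (v : Fin k → ℕ) (i : Fin k) : v i ≤ ∑ j, v j :=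
  single_le_sum (f := v) (fun _ _ => Nat.zero_le _) (mem_univ i)

/-- Graphs without `F` have linearly many edges. -/
theorem adjCount_univ_le_of_free (hk : 2 ≤ k) (hv : ∀ i, 2 ≤ v i) (hF : IsLinearForest F v)
    {V : Type*} [Fintype V] {G : SimpleGraph V} (hG : F.Free G) :
    adjCount G univ univ ≤ 4 * (∑ i, v i) * Fintype.card V := by
  set m := ∑ i, v i with hm
  by_contra! hcon
  refine hG (isContained_of_reserved hF (R := fun _ => ∅) (M := m) (by simp) ?_ ?_)
  · have : univ.biUnion (fun _ : Fin k => (∅ : Finset V)) = ∅ := by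
      ext
      simp
    simp [this, hm]
  intro i Z hZ _
  have h1 := adjCount_union_self (G := G) (disjoint_compl_right (a := Z))
  rw [union_compl] at h1
  have h2 := adjCount_le_mul (G := G) Z Z
  have h3 := adjCount_le_mul (G := G) Z Zᶜ
  have h4 := card_add_card_compl Z
  have hm2 : 2 ≤ m := hk.trans ((le_halfSum hv).trans (halfSum_le v))
  have hlt : 2 * m * #Zᶜ < adjCount G Zᶜ Zᶜ + 2 * ∑ w ∈ Zᶜ, 0 + 3 * #Zᶜ := by
    rw [← h4] at hcon
    have h5 : #Z * #Z ≤ m * #Z := Nat.mul_le_mul_right _ hZ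
    have h6 : #Z * #Zᶜ ≤ m * #Zᶜ := Nat.mul_le_mul_right _ hZ
    simp only [sum_const_zero]
    nlinarith
  obtain ⟨w, _, _, l, hl, hlZ, hlen⟩ := exists_isPathList_of_lt_weight (fun _ => 0) Zᶜ
    (fun _ _ => by simpa using hm2) hlt
  refine ⟨l, hl, ?_, fun x hx => mem_compl.1 (hlZ x hx)⟩
  have := le_sum_orders v i
  omega

/-- Two components are essential here: one of half-order at least `q` contributes only `q - 1`, and
another supplies the missing `1`. -/
theorem le_sum_min_half (hk : 2 ≤ k) (hv : ∀ i, 2 ≤ v i) {q : ℕ} (hq : 2 ≤ q)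
    (hqs : q ≤ halfSum v) : q ≤ ∑ i, min (v i / 2) (q - 1) := by
  by_cases h : ∃ i, q ≤ v i / 2
  · obtain ⟨i, hi⟩ := h
    obtain ⟨j, hj⟩ : ∃ j : Fin k, j ≠ i := by
      have : Nontrivial (Fin k) := Fin.nontrivial_iff_two_le.2 hk
      exact exists_ne i
    have h1 : ∑ x ∈ {i, j}, min (v x / 2) (q - 1) ≤ ∑ i, min (v i / 2) (q - 1) :=
      sum_le_sum_of_subset (subset_univ _)
    rw [sum_pair hj.symm] at h1
    have := hv j
    omega
  · push Not at h
    refine hqs.trans (sum_le_sum fun i _ => ?_)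
    have := h i
    omega

/-- If many disjoint paths on `q` vertices start in the common neighbourhood of `S`, and there are
many disjoint paths on `2 q - 1` vertices, then `F` is contained in the graph. -/
theorem isContained_of_isRich (hk : 2 ≤ k) (hv : ∀ i, 2 ≤ v i) (hF : IsLinearForest F v)
    {V : Type*} {G : SimpleGraph V} {M q : ℕ} (hM : 10 * ∑ i, v i ≤ M) {S : Finset V}
    (hq : 2 ≤ q) (hS : #S + q = halfSum v) (hR : IsRich G M q S)
    (hP : ∀ Z : Finset V, #Z ≤ M → ∃ l, IsPathList G l ∧ l.length + 1 = 2 * q ∧ ∀ x ∈ l, x ∉ Z) :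
    F ⊑ G := by
  have hsm := halfSum_le v
  -- Two arms on `q` vertices and `v i / 2 - (q - 1)` vertices of `S` give a path on `2 * (v i / 2)
  -- + 1` vertices; components with `v i / 2 ≤ q - 1` fit into a path on `2 * q - 1` vertices.
  have ht : ∑ i, (v i / 2 - (q - 1)) ≤ #S := by
    have h1 := le_sum_min_half hk hv hq (by omega)
    have h2 : ∑ i, (v i / 2 - (q - 1)) + ∑ i, min (v i / 2) (q - 1) = halfSum v := by
      rw [← sum_add_distrib]
      exact sum_congr rfl fun i _ => by omega
    omega
  obtain ⟨R, hRS, hRd⟩ := exists_pairwise_disjoint_subsets S _ ht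
  refine isContained_of_reserved hF hRd (M := 2 * ∑ i, v i) ?_ ?_
  · have : #(univ.biUnion R) ≤ #S := card_le_card (biUnion_subset.2 fun i _ => (hRS i).1)
    omega
  · intro i Z hZ hZR
    have hRi := (hRS i).2
    by_cases hi : v i / 2 ≤ q - 1
    · obtain ⟨l, h1, h2, h3⟩ := hP Z (by omega)
      exact ⟨l, h1, by omega, h3⟩
    · have hRc := card_le_card (hRS i).1
      obtain ⟨l, h1, h2, h3⟩ := (hR.subset (hRS i).1).exists_isPathList
        (card_pos.1 (by omega)) hZR (by omega)
      exact ⟨l, h1, by omega, h3⟩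

/-- For every set `A` there is a bounded set `B` outside of which the edges, including those to `A`,
are too few. -/
theorem exists_sparse_outside (hk : 2 ≤ k) (hv : ∀ i, 2 ≤ v i) (hF : IsLinearForest F v)
    {V : Type*} [Fintype V] {G : SimpleGraph V} (hG : F.Free G) {M : ℕ}
    (hM : 10 * ∑ i, v i ≤ M)
    (hU : ∀ U : Finset V, #U + 1 = halfSum v → ¬ IsRich G M 1 U) (A : Finset V) :
    ∃ B : Finset V, Disjoint A B ∧ #B ≤ 2 ^ #A * M ∧
      adjCount G (A ∪ B)ᶜ (A ∪ B)ᶜ + 2 * adjCount G (A ∪ B)ᶜ A + 3 * #(A ∪ B)ᶜ ≤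
        2 * halfSum v * #(A ∪ B)ᶜ := by
  -- For `#S + q = halfSum v` with `q ≥ 2`, `isContained_of_isRich` makes richness of `S` or the
  -- supply of paths on `2 * q - 1` vertices fail; `Z` witnesses the failure.
  have key : ∀ S : Finset V, ∃ Z : Finset V, #Z ≤ M ∧
      (#S + 1 = halfSum v → ∀ w, (∀ x ∈ S, G.Adj w x) → w ∈ Z) ∧
      ∀ q, 2 ≤ q → #S + q = halfSum v → ∀ w l l', IsPathList G (w :: l) → l.length + 1 = q →
        (∀ x ∈ w :: l, x ∉ Z) → (∀ x ∈ S, G.Adj w x) → IsPathList G l' →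
        l'.length + 1 = 2 * q → (∀ x ∈ l', x ∉ Z) → False := by
    intro S
    by_cases h1 : #S + 1 = halfSum v
    · have := hU S h1
      rw [IsRich] at this
      push Not at this
      obtain ⟨Z, hZ, hZ'⟩ := this
      refine ⟨Z, hZ, fun _ w hw => ?_, fun q _ _ => by omega⟩
      by_contra hwZ
      obtain ⟨x, hx, hwx⟩ := hZ' w [] (.singleton w) rfl (by simpa using hwZ)
      exact hwx (hw x hx)
    by_cases h2 : ∃ q, 2 ≤ q ∧ #S + q = halfSum v
    · obtain ⟨q, hq, hSq⟩ := h2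
      by_cases hR : IsRich G M q S
      · have : ¬ ∀ Z : Finset V, #Z ≤ M →
            ∃ l, IsPathList G l ∧ l.length + 1 = 2 * q ∧ ∀ x ∈ l, x ∉ Z := fun hP =>
          hG (isContained_of_isRich hk hv hF hM hq hSq hR hP)
        push Not at this
        obtain ⟨Z, hZ, hZ'⟩ := this
        refine ⟨Z, hZ, fun h => absurd h h1, fun q' _ hq' w l l' _ _ _ _ h5 h6 h7 => ?_⟩
        obtain rfl : q = q' := by omega
        obtain ⟨x, hx, hxZ⟩ := hZ' l' h5 h6
        exact h7 x hx hxZ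
      · rw [IsRich] at hR
        push Not at hR
        obtain ⟨Z, hZ, hZ'⟩ := hR
        refine ⟨Z, hZ, fun h => absurd h h1, fun q' _ hq' w l l' h1 h2 h3 h4 _ _ _ => ?_⟩
        obtain rfl : q = q' := by omega
        obtain ⟨x, hx, hwx⟩ := hZ' w l h1 h2 h3
        exact hwx (h4 x hx)
    · push Not at h2
      exact ⟨∅, by simp, fun h => absurd h h1, fun q hq hSq => absurd hSq (h2 q hq)⟩
  choose Z hZM hZ1 hZ2 using key
  have hAB : A ∪ A.powerset.biUnion Z \ A = A ∪ A.powerset.biUnion Z := union_sdiff_self_eq_union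
  refine ⟨A.powerset.biUnion Z \ A, disjoint_sdiff, ?_, ?_⟩
  · refine (card_le_card sdiff_subset).trans ?_
    rw [← card_powerset]
    exact card_biUnion_le_card_mul _ _ _ fun S _ => hZM S
  rw [hAB]
  have hout : ∀ w ∈ (A ∪ A.powerset.biUnion Z)ᶜ, ∀ S ⊆ A, w ∉ Z S := by
    intro w hw S hS hwS
    simp only [compl_union, mem_inter, mem_compl, mem_biUnion, not_exists, not_and] at hw
    exact hw.2 S (mem_powerset.2 hS) hwS
  by_contra! hcon
  obtain ⟨w, hw, ⟨l, h1, h2, h3⟩, l', h1', h2', h3'⟩ :=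
    exists_isPathList_of_lt_weight (G := G) (s := halfSum v) (fun w => #{x ∈ A | G.Adj w x})
      (A ∪ A.powerset.biUnion Z)ᶜ (by
        -- A vertex with `halfSum v - 1` neighbours in `A` would lie in `Z S` for some set `S` of
        -- such neighbours.
        intro w hw
        by_contra! hcon'
        obtain ⟨S, hS, hSc⟩ := exists_subset_card_eq (s := {x ∈ A | G.Adj w x})
          (n := halfSum v - 1) (by omega)
        have := le_halfSum hv
        exact hout w hw S (hS.trans (filter_subset _ _)) (hZ1 S (by omega) w fun x hx =>
          (mem_filter.1 (hS hx)).2)) hcon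
  refine hZ2 {x ∈ A | G.Adj w x} (l.length + 1) ?_ (by omega) w l l' h1 rfl
    (fun x hx => hout x (h2 x hx) _ (filter_subset _ _)) (by simp) h1' (by omega)
    (fun x hx => hout x (h2' x hx) _ (filter_subset _ _))
  by_contra! hcon'
  refine hout w hw _ (filter_subset _ _) (hZ1 {x ∈ A | G.Adj w x} (by omega) w (by simp))

/-- Up to constants there are `(2 * s - 2) * n` ordered pairs in total, but at most `(2 * s - 3) *
n` outside `A ∪ B` or between that part and `A`. So each round gains `n` pairs at `B`. -/
theorem exists_many_edges_to (hk : 2 ≤ k) (hv : ∀ i, 2 ≤ v i) (hF : IsLinearForest F v) {M : ℕ}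
    (hM : 10 * ∑ i, v i ≤ M) (C₀ j : ℕ) :
    ∃ K C, ∀ (V : Type u) [Fintype V] (G : SimpleGraph V), F.Free G →
      2 * halfSum v * Fintype.card V ≤ adjCount G univ univ + 2 * Fintype.card V + C₀ →
      (∀ U : Finset V, #U + 1 = halfSum v → ¬ IsRich G M 1 U) →
      ∃ A : Finset V, #A ≤ K ∧ j * Fintype.card V ≤ 2 * adjCount G Aᶜ A + C := by
  induction j with
  | zero => exact ⟨0, 0, fun V _ G _ _ _ => ⟨∅, by simp⟩⟩
  | succ j ih =>
    obtain ⟨K, C, h⟩ := ih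
    set K' := K + 2 ^ K * M with hK'
    refine ⟨K', C + C₀ + 3 * (K' * K'), fun V _ G hG hcard hU => ?_⟩
    obtain ⟨A, hA, hAj⟩ := h V G hG hcard hU
    obtain ⟨B, hAB, hB, hsp⟩ := exists_sparse_outside hk hv hF hG hM hU A
    have hB' : #B ≤ 2 ^ K * M :=
      hB.trans (Nat.mul_le_mul_right _ (Nat.pow_le_pow_right (by norm_num) hA))
    have hABc := card_union_of_disjoint hAB
    have hK : #(A ∪ B) ≤ K' := by omega
    refine ⟨A ∪ B, hK, ?_⟩
    have h1 := adjCount_union_self (G := G) (disjoint_compl_right (a := A ∪ B))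
    rw [union_compl, adjCount_comm G (A ∪ B) (A ∪ B)ᶜ] at h1
    have h2 : adjCount G (A ∪ B) (A ∪ B) ≤ K' * K' :=
      (adjCount_le_mul _ _).trans (Nat.mul_le_mul hK hK)
    have h3 := adjCount_union_right (G := G) (A ∪ B)ᶜ hAB
    have h4 : adjCount G Aᶜ A = adjCount G (A ∪ B)ᶜ A + adjCount G B A := by
      rw [← adjCount_union_left]
      · congr 1
        ext x
        have : x ∈ B → x ∉ A := fun hx hx' => Finset.disjoint_left.1 hAB hx' hx
        simp only [mem_compl, mem_union]
        tauto
      · exact (disjoint_compl_left).mono_right subset_union_right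
    have h5 : adjCount G B A ≤ K' * K' :=
      (adjCount_le_mul _ _).trans (Nat.mul_le_mul (by omega) (by omega))
    have h6 := card_add_card_compl (A ∪ B)
    have hs : 2 ≤ halfSum v := hk.trans (le_halfSum hv)
    have h7 : 2 * halfSum v * #(A ∪ B)ᶜ + 3 * #(A ∪ B) ≤
        2 * halfSum v * Fintype.card V := by
      rw [← h6, mul_add]
      nlinarith
    rw [add_mul, one_mul]
    omega

/-- A graph without `F` and with nearly as many edges as possible contains `s - 1` vertices with
many common neighbours, where `s = halfSum v`. -/
theorem exists_isRich_of_free (hk : 2 ≤ k) (hv : ∀ i, 2 ≤ v i) (hF : IsLinearForest F v) {M : ℕ}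
    (hM : 10 * ∑ i, v i ≤ M) (C₀ : ℕ) :
    ∃ N, ∀ (V : Type u) [Fintype V] (G : SimpleGraph V), N ≤ Fintype.card V → F.Free G →
      2 * halfSum v * Fintype.card V ≤ adjCount G univ univ + 2 * Fintype.card V + C₀ →
      ∃ U : Finset V, #U + 1 = halfSum v ∧ IsRich G M 1 U := by
  obtain ⟨K, C, h⟩ := exists_many_edges_to.{u} hk hv hF hM C₀ (4 * (∑ i, v i) + 1)
  refine ⟨C + 1, fun V _ G hN hG hcard => ?_⟩
  by_contra! hU
  obtain ⟨A, -, hA⟩ := h V G hG hcard hU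
  have h1 := adjCount_univ_le_of_free hk hv hF hG
  have h2 := adjCount_union_self (G := G) (disjoint_compl_left (a := A))
  rw [union_comm, union_compl] at h2
  rw [add_mul, one_mul] at hA
  omega

/-! ### Equality in the counts, and saving a vertex of `U` -/

theorem adj_of_mul_le_adjCount {A B : Finset V} (h : #A * #B ≤ adjCount G A B) :
    ∀ a ∈ A, ∀ b ∈ B, G.Adj a b := by
  intro a ha b hb
  by_contra hab
  refine absurd h (not_le.2 ?_)
  rw [← smul_eq_mul, ← sum_const]
  refine sum_lt_sum (fun a _ => card_filter_le _ _) ⟨a, ha, ?_⟩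
  exact card_lt_card (filter_ssubset.2 ⟨b, hb, hab⟩)

theorem adj_of_mul_le_adjCount_self {A : Finset V} (h : #A * (#A - 1) ≤ adjCount G A A) :
    ∀ a ∈ A, ∀ b ∈ A, a ≠ b → G.Adj a b := by
  intro a ha b hb hne
  by_contra hab
  refine absurd h (not_le.2 ?_)
  have hsub : ∀ x : V, {y ∈ A | G.Adj x y} ⊆ A.erase x := fun x y hy => by
    simp only [mem_filter, mem_erase] at hy ⊢
    exact ⟨hy.2.ne', hy.1⟩
  rw [← smul_eq_mul, ← sum_const]
  refine sum_lt_sum (fun x hx => ?_) ⟨a, ha, ?_⟩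
  · rw [← card_erase_of_mem hx]
    exact card_le_card (hsub x)
  · rw [← card_erase_of_mem ha]
    refine card_lt_card ((hsub a).ssubset_of_ne fun h => hab ?_)
    have : b ∈ A.erase a := mem_erase.2 ⟨hne.symm, hb⟩
    rw [← h] at this
    exact (mem_filter.1 this).2

/-- If the `j`-th path can be found with one vertex of `U` less than it would need in general, then
`F` is contained in the graph. -/
theorem isContained_of_saving (hv : ∀ i, 2 ≤ v i) (hF : IsLinearForest F v) {M : ℕ}
    (hM : 10 * ∑ i, v i ≤ M) {U : Finset V} (hU : #U + 1 = halfSum v) (hR : IsRich G M 1 U)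
    (j : Fin k) {U' X : Finset V} (hU' : U' ⊆ U) (hU'c : #U' < v j / 2)
    (hX : Disjoint U X) (hXc : #X ≤ 2 * ∑ i, v i)
    (h : ∀ Z : Finset V, #Z ≤ 4 * ∑ i, v i → Disjoint Z (U' ∪ X) →
      ∃ l, IsPathList G l ∧ v j ≤ l.length ∧ ∀ x ∈ l, x ∉ Z) : F ⊑ G := by
  have hsm := halfSum_le v
  -- What `U'` leaves of `U` suffices for the full demand of all other components.
  have ht : ∑ i, (if i = j then 0 else v i / 2) ≤ #(U \ U') := by
    have h1 : ∑ i, (if i = j then 0 else v i / 2) + v j / 2 = halfSum v := by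
      have h2 : v j / 2 = ∑ i, if i = j then v i / 2 else 0 := by simp
      rw [h2, ← sum_add_distrib]
      exact sum_congr rfl fun i _ => by split_ifs <;> simp
    rw [card_sdiff_of_subset hU']
    omega
  obtain ⟨R, hRS, hRd⟩ := exists_pairwise_disjoint_subsets _ _ ht
  have hRU : ∀ i, R i ⊆ U := fun i => (hRS i).1.trans sdiff_subset
  have hdj : ∀ i, Disjoint (R i) (U' ∪ X) := fun i => by
    rw [disjoint_union_right]
    exact ⟨disjoint_of_subset_left (hRS i).1 sdiff_disjoint, disjoint_of_subset_left (hRU i) hX⟩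
  refine isContained_of_reserved hF (R := Function.update R j (U' ∪ X))
    (M := 4 * ∑ i, v i) ?_ ?_ ?_
  · intro a b hab
    by_cases ha : a = j
    · subst ha
      rw [Function.update_self, Function.update_of_ne hab.symm]
      exact (hdj b).symm
    · rw [Function.update_of_ne ha]
      by_cases hb : b = j
      · subst hb
        rw [Function.update_self]
        exact hdj a
      · rw [Function.update_of_ne hb]
        exact hRd a b hab
  · have h1 : univ.biUnion (Function.update R j (U' ∪ X)) ⊆ U ∪ X := by
      refine biUnion_subset.2 fun i _ => ?_
      by_cases hi : i = j
      · subst hi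
        rw [Function.update_self]
        exact union_subset_union_left hU'
      · rw [Function.update_of_ne hi]
        exact (hRU i).trans subset_union_left
    have h2 := (card_le_card h1).trans (card_union_le _ _)
    omega
  · intro i Z hZ hZR
    by_cases hi : i = j
    · subst hi
      rw [Function.update_self] at hZR
      exact h Z hZ hZR
    · rw [Function.update_of_ne hi] at hZR
      have hc := (hRS i).2
      rw [if_neg hi] at hc
      have hvi := hv i
      have hRc := card_le_card (hRU i)
      obtain ⟨l, h1, h2, h3⟩ := (hR.subset (hRU i)).exists_isPathList
        (card_pos.1 (by omega)) hZR (by omega)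
      exact ⟨l, h1, by omega, h3⟩

theorem isContained_of_isPathList_outside (hv : ∀ i, 2 ≤ v i)
    (hF : IsLinearForest F v) {M : ℕ}
    (hM : 10 * ∑ i, v i ≤ M) {U : Finset V} (hU : #U + 1 = halfSum v) (hR : IsRich G M 1 U)
    (j : Fin k) {l : List V} (hl : IsPathList G l) (hlU : ∀ x ∈ l, x ∉ U) (hlen : v j ≤ l.length) :
    F ⊑ G := by
  have hvj := hv j
  have hc := (l.take (v j)).toFinset_card_le
  have := le_sum_orders v j
  refine isContained_of_saving hv hF hM hU hR j (U' := ∅) (X := (l.take (v j)).toFinset)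
    (by simp) (by simp; omega) ?_ ?_ ?_
  · rw [Finset.disjoint_right]
    exact fun x hx => hlU x (List.mem_of_mem_take (List.mem_toFinset.1 hx))
  · simp only [List.length_take] at hc
    omega
  · intro Z _ hZ
    refine ⟨l.take (v j), hl.take _, by simpa using hlen, fun x hx hxZ => ?_⟩
    exact Finset.disjoint_left.1 hZ hxZ (by simpa using hx)

/-- With only `v j / 2 - 1` vertices of `U`, joining `P` and `Q` gives `P.length + Q.length + 2 * (v
j / 2) - 3` vertices. -/
theorem isContained_of_arms (hk : 2 ≤ k) (hv : ∀ i, 2 ≤ v i) (hF : IsLinearForest F v) {M : ℕ}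
    (hM : 10 * ∑ i, v i ≤ M) {U : Finset V} (hU : #U + 1 = halfSum v) (hR : IsRich G M 1 U)
    (j : Fin k) (hj : 2 ≤ v j / 2) {u : V} (hu : u ∈ U) {P Q : List V}
    (hP : IsPathList G P) (hQ : IsPathList G Q) (hPadj : ∀ a ∈ P.head?, ∀ x ∈ U, G.Adj a x)
    (hQadj : ∀ b ∈ Q.head?, G.Adj u b) (hPQ : P.Disjoint Q) (hPU : ∀ x ∈ P, x ∉ U)
    (hQU : ∀ x ∈ Q, x ∉ U) (hc : P.length + Q.length ≤ 4)
    (hlen : v j + 3 ≤ P.length + Q.length + 2 * (v j / 2)) : F ⊑ G := by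
  have hvj := le_sum_orders v j
  have hsj := half_lt_halfSum hk hv j
  obtain ⟨U', huU', hU', hU'c⟩ := exists_subsuperset_card_eq (s := {u}) (t := U)
    (n := v j / 2 - 1) (by simpa using hu) (by rw [card_singleton]; omega) (by omega)
  have hPc := P.toFinset_card_le
  have hQc := Q.toFinset_card_le
  have hPQc := card_union_le P.toFinset Q.toFinset
  refine isContained_of_saving hv hF hM hU hR j (U' := U') (X := P.toFinset ∪ Q.toFinset)
    hU' (by omega) ?_ (by omega) ?_
  · rw [Finset.disjoint_right]
    intro x hx
    simp only [mem_union, List.mem_toFinset] at hx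
    exact hx.elim (hPU x) (hQU x)
  · intro Z hZ hZd
    rw [disjoint_union_right, disjoint_union_right] at hZd
    obtain ⟨hZU, hZP, hZQ⟩ := hZd
    obtain ⟨l, h1, h2, h3⟩ := (hR.subset hU').exists_join (huU' (mem_singleton_self u)) hP hQ
      (fun a ha x hx => hPadj a ha x (hU' hx)) hQadj hPQ (fun x hx h => hPU x hx (hU' h))
      (fun x hx h => hQU x hx (hU' h))
      (fun x hx h => Finset.disjoint_left.1 hZP h (List.mem_toFinset.2 hx))
      (fun x hx h => Finset.disjoint_left.1 hZQ h (List.mem_toFinset.2 hx)) hZU (by omega)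
    exact ⟨l, h1, by omega, h3⟩

/-- The second arm is a single common neighbour of `U`. -/
theorem isContained_of_arm (hk : 2 ≤ k) (hv : ∀ i, 2 ≤ v i) (hF : IsLinearForest F v) {M : ℕ}
    (hM : 10 * ∑ i, v i ≤ M) {U : Finset V} (hU : #U + 1 = halfSum v) (hR : IsRich G M 1 U)
    (j : Fin k) (hj : 2 ≤ v j / 2) {u : V} (hu : u ∈ U) {Q : List V} (hQ : IsPathList G Q)
    (hQadj : ∀ b ∈ Q.head?, G.Adj u b) (hQU : ∀ x ∈ Q, x ∉ U) (hc : Q.length ≤ 3)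
    (hlen : v j + 2 ≤ Q.length + 2 * (v j / 2)) : F ⊑ G := by
  have hvj := le_sum_orders v j
  have hsm := halfSum_le v
  obtain ⟨y, l, h1, h2, h3, h4⟩ := hR (U ∪ Q.toFinset) (by
    have := card_union_le U Q.toFinset
    have := Q.toFinset_card_le
    omega)
  have hy := h3 y (by simp)
  simp only [mem_union, List.mem_toFinset, not_or] at hy
  refine isContained_of_arms hk hv hF hM hU hR j hj hu (.singleton y) hQ (by simpa using h4) hQadj
    (by simpa using hy.2) (by simpa using hy.1) hQU (by simp; omega) (by simp; omega)

/-- The vertices of `U` are universal, and the other vertices span exactly one edge if `odd` holds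
and no edge otherwise. -/
structure IsExtremalStructure (G : SimpleGraph V) (U : Finset V) (odd : Prop) : Prop where
  universal : ∀ x ∈ U, ∀ y, x ≠ y → G.Adj x y
  independent : ¬ odd → ∀ x ∉ U, ∀ y ∉ U, ¬ G.Adj x y
  edge : odd → ∃ a ∉ U, ∃ b ∉ U, G.Adj a b ∧
    ∀ x ∉ U, ∀ y ∉ U, G.Adj x y → x = a ∧ y = b ∨ x = b ∧ y = a

/-! ### Structure of dense `F`-free graphs around `U` -/

section Structure

variable (hk : 2 ≤ k) (hv : ∀ i, 2 ≤ v i) (hF : IsLinearForest F v) {M : ℕ}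
  (hM : 10 * ∑ i, v i ≤ M) {U : Finset V} (hU : #U + 1 = halfSum v) (hR : IsRich G M 1 U)
  (hG : F.Free G)

include hk hv hF hM hU hR hG

/-- The arm `b, a` saves a vertex of `U` for an even component; if that component has order `2`, the
edge itself serves. -/
theorem not_adj_of_even {j : Fin k} (hj : ¬ Odd (v j)) {a b u : V} (ha : a ∉ U) (hb : b ∉ U)
    (hu : u ∈ U) (hbu : G.Adj b u) : ¬ G.Adj b a := by
  intro hab
  have hp : IsPathList G [b, a] := (IsPathList.singleton a).cons (by simpa using hab.ne)
    (by simpa using hab)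
  have hl : ∀ x ∈ [b, a], x ∉ U := by simp [ha, hb]
  rw [Nat.not_odd_iff] at hj
  by_cases h2 : v j / 2 < 2
  · exact hG (isContained_of_isPathList_outside hv hF hM hU hR j hp hl (by simp; omega))
  · exact hG (isContained_of_arm hk hv hF hM hU hR j (by omega) hu hp (by simpa using hbu.symm) hl
      (by simp) (by simp; omega))

theorem not_adj_of_half_ge {j : Fin k} (hj : 2 ≤ v j / 2) {a b c u : V} (ha : a ∉ U)
    (hb : b ∉ U) (hc : c ∉ U) (hu : u ∈ U) (hau : G.Adj a u) (hab : G.Adj a b) (hac : a ≠ c) :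
    ¬ G.Adj b c := by
  intro hbc
  have hp : IsPathList G [a, b, c] :=
    ((IsPathList.singleton c).cons (by simpa using hbc.ne) (by simpa using hbc)).cons
    (by simpa using ⟨hab.ne, hac⟩) (by simpa using hab)
  exact hG (isContained_of_arm hk hv hF hM hU hR j hj hu hp (by simpa using hau.symm)
    (by simp [ha, hb, hc]) (by simp) (by simp; omega))

theorem not_universal_of_two_edges {j : Fin k} (hj : 2 ≤ v j / 2) {a b c d u : V} (ha : a ∉ U)
    (hb : b ∉ U) (hc : c ∉ U) (hd : d ∉ U) (hab : G.Adj a b) (hcd : G.Adj c d) (hac : a ≠ c)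
    (had : a ≠ d) (hbc : b ≠ c) (hbd : b ≠ d) (hu : u ∈ U) (hcu : G.Adj c u) :
    ∃ x ∈ U, ¬ G.Adj a x := by
  by_contra! hcon
  have hp : IsPathList G [a, b] :=
    (IsPathList.singleton b).cons (by simpa using hab.ne) (by simpa using hab)
  have hq : IsPathList G [c, d] :=
    (IsPathList.singleton d).cons (by simpa using hcd.ne) (by simpa using hcd)
  exact hG (isContained_of_arms hk hv hF hM hU hR j hj hu hp hq (by simpa using hcon)
    (by simpa using hcu.symm) (by simp [hac.symm, had.symm, hbc.symm, hbd.symm]) (by simp [ha, hb])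
    (by simp [hc, hd]) (by simp) (by simp; omega))

/-- The edges that meet vertices without neighbours in `U` are few. -/
theorem adjCount_le_of_not_adj {J T : Finset V} (hJ : Disjoint J U) (hT : Disjoint T U)
    (hTU : ∀ w ∈ T, ∃ u ∈ U, G.Adj w u)
    (hodd : (∀ i, Odd (v i)) → ∃ j, 2 ≤ v j / 2) (hJT : Disjoint J T) :
    adjCount G J J + 2 * adjCount G J T + #J ≤ 2 * #U * #J := by
  have hs : 2 ≤ halfSum v := hk.trans (le_halfSum hv)
  have hJ' : ∀ x ∈ J, x ∉ U := fun x hx => Finset.disjoint_left.1 hJ hx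
  have hT' : ∀ x ∈ T, x ∉ U := fun x hx => Finset.disjoint_left.1 hT hx
  have hf : ∀ w ∈ J, #{t ∈ T | G.Adj w t} + 2 ≤ halfSum v := by
    intro w hw
    by_cases ho : ∀ i, Odd (v i)
    · obtain ⟨j, hj⟩ := hodd ho
      have h3 := half_lt_halfSum hk hv j
      have : #{t ∈ T | G.Adj w t} ≤ 1 := by
        rw [card_le_one]
        intro a ha b hb
        rw [mem_filter] at ha hb
        by_contra hab
        obtain ⟨u, hu, hau⟩ := hTU a ha.1
        exact not_adj_of_half_ge hk hv hF hM hU hR hG hj (hT' a ha.1) (hJ' w hw) (hT' b hb.1)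
          hu hau ha.2.symm hab hb.2
      omega
    · push Not at ho
      obtain ⟨j, hj⟩ := ho
      have : #{t ∈ T | G.Adj w t} = 0 := by
        rw [card_eq_zero, filter_eq_empty_iff]
        intro t ht hwt
        obtain ⟨u, hu, htu⟩ := hTU t ht
        exact not_adj_of_even hk hv hF hM hU hR hG (by simpa using hj) (hJ' w hw) (hT' t ht) hu
          htu hwt.symm
      omega
  by_contra! hcon
  -- As `#U = halfSum v - 1`, the failed bound is exactly the hypothesis of the weighted theorem.
  have hlt : 2 * halfSum v * #J < adjCount G J J + 2 * ∑ w ∈ J, #{t ∈ T | G.Adj w t} + 3 * #J := by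
    rw [← hU]
    have : adjCount G J T = ∑ w ∈ J, #{t ∈ T | G.Adj w t} := rfl
    rw [← this, mul_add, add_mul]
    omega
  obtain ⟨w, hw, ⟨l, h1, h2, h3⟩, l', h1', h2', h3'⟩ := exists_isPathList_of_lt_weight _ J hf hlt
  rcases Nat.eq_zero_or_pos #{t ∈ T | G.Adj w t} with h0 | hpos
  · rw [h0] at h3'
    let j : Fin k := ⟨0, by omega⟩
    have hj := half_lt_halfSum hk hv j
    exact hG (isContained_of_isPathList_outside hv hF hM hU hR j h1'
      (fun x hx => hJ' x (h2' x hx)) (by omega))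
  · obtain ⟨t, ht⟩ := card_pos.1 hpos
    rw [mem_filter] at ht
    obtain ⟨u, hu, htu⟩ := hTU t ht.1
    by_cases ho : ∀ i, Odd (v i)
    · obtain ⟨j, hj⟩ := hodd ho
      have h4 := hf w hw
      -- By `hf` the path from `w` has a second vertex `z`, so `t, w, z` is a forbidden path.
      cases l with
      | nil =>
        simp only [List.length_nil] at h3
        omega
      | cons z l =>
        have hz := h2 z (by simp)
        have hwz : G.Adj w z := by
          have := h1.chain
          simp only [List.isChain_cons_cons] at this
          exact this.1
        refine not_adj_of_half_ge hk hv hF hM hU hR hG hj (hT' t ht.1) (hJ' w hw) (hJ' z hz) hu htu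
          ht.2.symm ?_ hwz
        rintro rfl
        exact Finset.disjoint_left.1 hJT hz ht.1
    · push Not at ho
      obtain ⟨j, hj⟩ := ho
      exact not_adj_of_even hk hv hF hM hU hR hG (by simpa using hj) (hJ' w hw) (hT' t ht.1) hu
        htu ht.2.symm

/-- Among vertices with a neighbour in `U`, either there is exactly one edge or the edges do not
make up for the missing edges to `U`. -/
theorem exists_unique_edge {j : Fin k} (hj : 2 ≤ v j / 2) {T : Finset V} (hT : Disjoint T U)
    (hTU : ∀ w ∈ T, ∃ u ∈ U, G.Adj w u)
    (hlt : 2 * #U * #T < adjCount G T T + 2 * adjCount G T U) :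
    ∃ a ∈ T, ∃ b ∈ T, G.Adj a b ∧ (∀ x ∈ T, ∀ y ∈ T, G.Adj x y → x = a ∧ y = b ∨ x = b ∧ y = a) ∧
      adjCount G T T ≤ 2 := by
  have hT' : ∀ x ∈ T, x ∉ U := fun x hx => Finset.disjoint_left.1 hT hx
  have huniq : ∀ a ∈ T, ∀ b ∈ T, ∀ c ∈ T, G.Adj b a → G.Adj b c → a = c := by
    intro a ha b hb c hc hba hbc
    by_contra hac
    obtain ⟨u, hu, hau⟩ := hTU a ha
    exact not_adj_of_half_ge hk hv hF hM hU hR hG hj (hT' a ha) (hT' b hb) (hT' c hc) hu hau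
      hba.symm hac hbc
  have hdeg : ∀ w ∈ T, #{x ∈ T | G.Adj w x} ≤ 1 := by
    intro w hw
    rw [card_le_one]
    intro a ha b hb
    rw [mem_filter] at ha hb
    exact huniq a ha.1 w hw b hb.1 ha.2 hb.2
  -- By averaging, some `w` exceeds `2 * #U`; having at most one neighbour in `T`, it has exactly
  -- one and is joined to all of `U`.
  obtain ⟨w, hw, hwlt⟩ : ∃ w ∈ T, 2 * #U < #{x ∈ T | G.Adj w x} + 2 * #{x ∈ U | G.Adj w x} := by
    by_contra! hcon
    have := sum_le_sum hcon
    rw [sum_add_distrib, ← mul_sum, sum_const, smul_eq_mul] at this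
    change adjCount G T T + 2 * adjCount G T U ≤ _ at this
    rw [mul_comm #T] at this
    omega
  have hwU : #{x ∈ U | G.Adj w x} ≤ #U := card_filter_le _ _
  have hw1 := hdeg w hw
  obtain ⟨b, hb⟩ : ({x ∈ T | G.Adj w x} : Finset V).Nonempty := card_pos.1 (by omega)
  rw [mem_filter] at hb
  have hfull : ∀ x ∈ U, G.Adj w x := by
    have : ({x ∈ U | G.Adj w x} : Finset V) = U :=
      eq_of_subset_of_card_le (filter_subset _ _) (by omega)
    exact filter_eq_self.1 this
  have hunique : ∀ x ∈ T, ∀ y ∈ T, G.Adj x y → x = w ∧ y = b ∨ x = b ∧ y = w := by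
    intro x hx y hy hxy
    by_cases hxw : x = w
    · subst hxw
      exact Or.inl ⟨rfl, huniq y hy x hx b hb.1 hxy hb.2⟩
    by_cases hxb : x = b
    · subst hxb
      exact Or.inr ⟨rfl, huniq y hy x hx w hw hxy hb.2.symm⟩
    exfalso
    have hwy : w ≠ y := by
      rintro rfl
      exact hxb (huniq x hx w hw b hb.1 hxy.symm hb.2)
    have hby : b ≠ y := by
      rintro rfl
      exact hxw (huniq x hx b hb.1 w hw hxy.symm hb.2.symm)
    obtain ⟨u, hu, hxu⟩ := hTU x hx
    obtain ⟨z, hz, hwz⟩ := not_universal_of_two_edges hk hv hF hM hU hR hG hj (hT' w hw)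
      (hT' b hb.1) (hT' x hx) (hT' y hy) hb.2 hxy (Ne.symm hxw) hwy (Ne.symm hxb) hby hu hxu
    exact hwz (hfull z hz)
  refine ⟨w, hw, b, hb.1, hb.2, hunique, ?_⟩
  have h0 : ∀ x ∈ T, x ∉ ({w, b} : Finset V) → #{y ∈ T | G.Adj x y} = 0 := by
    intro x hx hxwb
    rw [card_eq_zero, filter_eq_empty_iff]
    intro y hy hxy
    simp only [mem_insert, mem_singleton, not_or] at hxwb
    rcases hunique x hx y hy hxy with h | h
    exacts [hxwb.1 h.1, hxwb.2 h.1]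
  have hsub : ({w, b} : Finset V) ⊆ T := by
    simp [insert_subset_iff, hw, hb.1]
  rw [adjCount, ← sum_subset hsub h0]
  refine (sum_le_card_nsmul _ _ 1 fun x hx => hdeg x (hsub hx)).trans ?_
  simpa using card_le_two

/-- Compared with a complete join to `U`, the part `J` loses at least `#J` pairs, while `T` gains at
most `2` in the odd case and none otherwise. So `hcard` leaves no slack. -/
theorem isExtremalStructure_of_free [Fintype V] (h3 : ∃ i, v i ≠ 3)
    (hcard : #U * (#U - 1) + 2 * #U * (Fintype.card V - #U) + (if ∀ i, Odd (v i) then 2 else 0) ≤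
      adjCount G univ univ) : IsExtremalStructure G U (∀ i, Odd (v i)) := by
  have hodd : (∀ i, Odd (v i)) → ∃ j, 2 ≤ v j / 2 := by
    intro ho
    obtain ⟨j, hj⟩ := h3
    refine ⟨j, ?_⟩
    have h1 := hv j
    have h2 := Nat.odd_iff.1 (ho j)
    omega
  set T : Finset V := {w ∈ Uᶜ | ∃ u ∈ U, G.Adj w u} with hTdef
  set J : Finset V := {w ∈ Uᶜ | ¬ ∃ u ∈ U, G.Adj w u} with hJdef
  have hJT : Disjoint J T := (disjoint_filter_filter_not _ _ _).symm
  have hJTU : J ∪ T = Uᶜ := by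
    rw [union_comm]
    exact filter_union_filter_not_eq _ _
  have hT : Disjoint T U := disjoint_of_subset_left (filter_subset _ _) disjoint_compl_left
  have hJ : Disjoint J U := disjoint_of_subset_left (filter_subset _ _) disjoint_compl_left
  have hTU : ∀ w ∈ T, ∃ u ∈ U, G.Adj w u := fun w hw => (mem_filter.1 hw).2
  have e1 := adjCount_union_self (G := G) (disjoint_compl_left (a := U))
  rw [union_comm, union_compl] at e1
  have e2 := adjCount_union_self (G := G) hJT
  have e3 := adjCount_union_left (G := G) hJT U
  have e4 := card_union_of_disjoint hJT
  rw [hJTU] at e2 e3 e4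
  have e5 : adjCount G J U = 0 := sum_eq_zero fun x hx => by
    rw [card_eq_zero, filter_eq_empty_iff]
    intro u hu hxu
    exact (mem_filter.1 hx).2 ⟨u, hu, hxu⟩
  have e6 := adjCount_le_of_not_adj hk hv hF hM hU hR hG hJ hT hTU hodd hJT
  have e7 := adjCount_self_le (G := G) U
  have e8 := adjCount_le_mul (G := G) T U
  rw [← card_compl, e4, mul_add] at hcard
  have e9 : 2 * #U * #T = 2 * (#T * #U) := by ring
  have key : adjCount G T T ≤ (if ∀ i, Odd (v i) then 2 else 0) →
      #J = 0 ∧ #U * (#U - 1) ≤ adjCount G U U ∧ #T * #U ≤ adjCount G T U := by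
    intro hTT
    refine ⟨?_, ?_, ?_⟩ <;> omega
  have hfinal : adjCount G T T ≤ (if ∀ i, Odd (v i) then 2 else 0) →
      T = Uᶜ ∧ ∀ x ∈ U, ∀ y, x ≠ y → G.Adj x y := by
    intro hTT
    obtain ⟨k1, k2, k3⟩ := key hTT
    rw [card_eq_zero] at k1
    rw [k1, empty_union] at hJTU
    refine ⟨hJTU, fun x hx y hxy => ?_⟩
    by_cases hy : y ∈ U
    · exact adj_of_mul_le_adjCount_self k2 x hx y hy hxy
    · exact (adj_of_mul_le_adjCount k3 y (by rw [hJTU]; simpa using hy) x hx).symm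
  by_cases ho : ∀ i, Odd (v i)
  · obtain ⟨j, hj⟩ := hodd ho
    rw [if_pos ho] at hcard hfinal
    obtain ⟨a, ha, b, hb, hab, huniq, hTT⟩ := exists_unique_edge hk hv hF hM hU hR hG hj hT hTU
      (by omega)
    obtain ⟨hTe, huniv⟩ := hfinal hTT
    have hmem : ∀ x, x ∈ T ↔ x ∉ U := by simp [hTe]
    refine ⟨huniv, fun h => absurd ho h, fun _ => ⟨a, (hmem a).1 ha, b, (hmem b).1 hb, hab, ?_⟩⟩
    exact fun x hx y hy => huniq x ((hmem x).2 hx) y ((hmem y).2 hy)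
  · rw [if_neg ho] at hfinal
    obtain ⟨j, hj⟩ : ∃ j, ¬ Odd (v j) := by simpa using ho
    have hnadj : ∀ x ∈ T, ∀ y ∈ T, ¬ G.Adj x y := by
      intro x hx y hy
      obtain ⟨u, hu, hxu⟩ := hTU x hx
      exact not_adj_of_even hk hv hF hM hU hR hG hj (Finset.disjoint_left.1 hT hy)
        (Finset.disjoint_left.1 hT hx) hu hxu
    have hTT : adjCount G T T ≤ 0 := (sum_eq_zero fun x hx => by
      rw [card_eq_zero, filter_eq_empty_iff]
      exact fun y hy => hnadj x hx y hy).le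
    obtain ⟨hTe, huniv⟩ := hfinal hTT
    have hmem : ∀ x, x ∈ T ↔ x ∉ U := by simp [hTe]
    exact ⟨huniv, fun _ x hx y hy => hnadj x ((hmem x).2 hx) y ((hmem y).2 hy),
      fun h => absurd h ho⟩

end Structure

/-! ### The extremal graph: freeness, size, isomorphism -/

theorem half_length_le_countP (U : Finset V) :
    ∀ l : List V, l.IsChain (fun x y => x ∈ U ∨ y ∈ U) → l.length / 2 ≤ l.countP (· ∈ U)
  | [], _ => by simp
  | [_], _ => by simp
  | x :: y :: l, h => by
    have ih := half_length_le_countP U l h.tail.tail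
    have hxy : x ∈ U ∨ y ∈ U := (List.isChain_cons_cons.1 h).1
    have : 1 ≤ (if x ∈ U then 1 else 0) + (if y ∈ U then 1 else 0) := by
      rcases hxy with h | h <;> simp [h]
    simp only [List.length_cons, List.countP_cons, decide_eq_true_eq]
    omega

theorem card_filter_mem_eq_countP {l : List V} (hl : l.Nodup) (U : Finset V) :
    #{x ∈ U | x ∈ l} = l.countP (· ∈ U) := by
  rw [List.countP_eq_length_filter, ← List.toFinset_card_of_nodup (hl.filter _)]
  congr 1
  ext x
  simp [and_comm]

namespace IsExtremalStructure

/-- An edge outside `U` can occur only in the odd case. Cutting the path there leaves one part of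
even and one of odd length, so no rounding loss arises when the halves are added. -/
theorem half_length_le {U : Finset V} {odd : Prop} (hG : IsExtremalStructure G U odd) {l : List V}
    (hl : IsPathList G l) (hodd : odd → Odd l.length) : l.length / 2 ≤ l.countP (· ∈ U) := by
  by_cases hch : l.IsChain (fun x y => x ∈ U ∨ y ∈ U)
  · exact half_length_le_countP U l hch
  rw [List.isChain_iff_forall_rel_of_append_cons_cons] at hch
  push Not at hch
  obtain ⟨x, y, l₁, l₂, rfl, hx, hy⟩ := hch
  have hxy : G.Adj x y := (List.isChain_cons_cons.1 hl.chain.right_of_append).1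
  by_cases ho : odd
  · obtain ⟨a, _, b, _, _, huniq⟩ := hG.edge ho
    have hpair : ∀ z ∉ U, ∀ w ∉ U, G.Adj z w → z = x ∧ w = y ∨ z = y ∧ w = x := by
      intro z hz w hw hzw
      rcases huniq z hz w hw hzw with ⟨rfl, rfl⟩ | ⟨rfl, rfl⟩ <;>
        rcases huniq x hx y hy hxy with ⟨rfl, rfl⟩ | ⟨rfl, rfl⟩ <;> simp
    have heq : l₁ ++ x :: y :: l₂ = (l₁ ++ [x]) ++ (y :: l₂) := by simp
    rw [heq] at hl hodd ⊢
    have hd := hl.disjoint_of_append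
    have h1 := half_length_le_countP U (l₁ ++ [x])
      (hl.left_of_append.chain.imp_of_mem_imp fun z w hz hw hzw => by
        by_contra! hcon
        rcases hpair z hcon.1 w hcon.2 hzw with h | h
        · exact hd hw (by simp [h.2])
        · exact hd hz (by simp [h.1]))
    have h2 := half_length_le_countP U (y :: l₂)
      (hl.right_of_append.chain.imp_of_mem_imp fun z w hz hw hzw => by
        by_contra! hcon
        rcases hpair z hcon.1 w hcon.2 hzw with h | h
        · exact hd (by simp [h.1]) hz
        · exact hd (by simp [h.2]) hw)
    rw [List.countP_append]
    have h3 := Nat.odd_iff.1 (hodd ho)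
    rw [List.length_append] at h3 ⊢
    omega
  · exact absurd hxy (hG.independent ho x hx y hy)

theorem free {U : Finset V} (hG : IsExtremalStructure G U (∀ i, Odd (v i)))
    (hF : IsLinearForest F v) (hU : #U < halfSum v) : F.Free G := by
  intro hcon
  obtain ⟨L, hL, hlen, hd⟩ := exists_isPathList_of_isContained hF hcon
  refine absurd hU (not_lt.2 ?_)
  calc halfSum v ≤ ∑ i, #{x ∈ U | x ∈ L i} := sum_le_sum fun i _ => by
        rw [card_filter_mem_eq_countP (hL i).nodup, ← hlen i]
        exact hG.half_length_le (hL i) fun ho => by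
          rw [hlen]
          exact ho i
    _ = #(univ.biUnion fun i => {x ∈ U | x ∈ L i}) := by
        rw [card_biUnion]
        intro i _ j _ hij
        rw [Function.onFun, Finset.disjoint_left]
        intro x hx hx'
        exact hd i j hij (mem_filter.1 hx).2 (mem_filter.1 hx').2
    _ ≤ #U := card_le_card (biUnion_subset.2 fun i _ => filter_subset _ _)

theorem adjCount_compl [Fintype V] {U : Finset V} {odd : Prop}
    (hG : IsExtremalStructure G U odd) : adjCount G Uᶜ Uᶜ = if odd then 2 else 0 := by
  by_cases ho : odd
  · obtain ⟨a, ha, b, hb, hab, huniq⟩ := hG.edge ho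
    have hsub : ({a, b} : Finset V) ⊆ Uᶜ := by simp [insert_subset_iff, ha, hb]
    rw [if_pos ho, adjCount, ← sum_subset hsub, sum_pair hab.ne]
    · have h1 : ({y ∈ Uᶜ | G.Adj a y} : Finset V) = {b} := by
        ext y
        simp only [mem_filter, mem_compl, mem_singleton]
        refine ⟨fun h => ?_, fun h => h ▸ ⟨hb, hab⟩⟩
        rcases huniq a ha y h.1 h.2 with h | h
        exacts [h.2, absurd h.1 hab.ne]
      have h2 : ({y ∈ Uᶜ | G.Adj b y} : Finset V) = {a} := by
        ext y
        simp only [mem_filter, mem_compl, mem_singleton]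
        refine ⟨fun h => ?_, fun h => h ▸ ⟨ha, hab.symm⟩⟩
        rcases huniq b hb y h.1 h.2 with h | h
        exacts [absurd h.1 hab.ne', h.2]
      rw [h1, h2, card_singleton, card_singleton]
    · intro x hx hxab
      rw [card_eq_zero, filter_eq_empty_iff]
      intro y hy hxy
      simp only [mem_insert, mem_singleton, not_or] at hxab
      rcases huniq x (mem_compl.1 hx) y (mem_compl.1 hy) hxy with h | h
      exacts [hxab.1 h.1, hxab.2 h.1]
  · rw [if_neg ho]
    refine sum_eq_zero fun x hx => ?_
    rw [card_eq_zero, filter_eq_empty_iff]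
    exact fun y hy => hG.independent ho x (mem_compl.1 hx) y (mem_compl.1 hy)

theorem adjCount_univ [Fintype V] {U : Finset V} {odd : Prop}
    (hG : IsExtremalStructure G U odd) :
    adjCount G univ univ = #U * (#U - 1) + 2 * #U * (Fintype.card V - #U) + if odd then 2 else 0 := by
  have e1 := adjCount_union_self (G := G) (disjoint_compl_right (a := U))
  rw [union_compl] at e1
  have h1 : adjCount G U U = #U * (#U - 1) := by
    rw [← smul_eq_mul]
    refine sum_eq_card_nsmul fun x hx => ?_
    rw [← card_erase_of_mem hx]
    congr 1
    ext y
    simp only [mem_filter, mem_erase]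
    exact ⟨fun h => ⟨h.2.ne', h.1⟩, fun h => ⟨h.2, hG.universal x hx y h.1.symm⟩⟩
  have h2 : adjCount G U Uᶜ = #U * #Uᶜ := by
    rw [← smul_eq_mul]
    refine sum_eq_card_nsmul fun x hx => ?_
    rw [filter_true_of_mem]
    exact fun y hy => hG.universal x hx y (by rintro rfl; exact mem_compl.1 hy hx)
  rw [e1, h1, h2, hG.adjCount_compl, card_compl]
  ring

/-- A permutation that respects the data describing two such graphs is an isomorphism. -/
theorem adj_iff {U : Finset V} {odd : Prop} (hG : IsExtremalStructure G U odd)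
    {G' : SimpleGraph V} {U' : Finset V} (hG' : IsExtremalStructure G' U' odd) (σ : Equiv.Perm V)
    (hσ : ∀ x, σ x ∈ U' ↔ x ∈ U)
    (hedge : ∀ x ∉ U, ∀ y ∉ U, G'.Adj (σ x) (σ y) ↔ G.Adj x y) (x y : V) :
    G'.Adj (σ x) (σ y) ↔ G.Adj x y := by
  by_cases hxy : x = y
  · subst hxy
    simp
  have hxy' : σ x ≠ σ y := σ.injective.ne hxy
  by_cases hx : x ∈ U
  · exact iff_of_true (hG'.universal _ ((hσ x).2 hx) _ hxy') (hG.universal x hx y hxy)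
  by_cases hy : y ∈ U
  · exact iff_of_true (hG'.universal _ ((hσ y).2 hy) _ hxy'.symm).symm
      (hG.universal y hy x (Ne.symm hxy)).symm
  exact hedge x hx y hy

theorem nonempty_iso [Fintype V] {U : Finset V} {odd : Prop} (hG : IsExtremalStructure G U odd)
    {G' : SimpleGraph V} {U' : Finset V} (hG' : IsExtremalStructure G' U' odd)
    (hUU' : #U = #U') : Nonempty (G ≃g G') := by
  obtain ⟨σ, hσ⟩ : ∃ σ : Equiv.Perm V, ∀ x, σ x ∈ U' ↔ x ∈ U := by
    let e : {x // x ∈ U} ≃ {x // x ∈ U'} := Finset.equivOfCardEq hUU'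
    refine ⟨e.extendSubtype, fun x => ⟨fun h => ?_, fun h => e.extendSubtype_mem x h⟩⟩
    by_contra hx
    exact e.extendSubtype_not_mem x hx h
  by_cases ho : odd
  · obtain ⟨a, ha, b, hb, hab, huniq⟩ := hG.edge ho
    obtain ⟨a', ha', b', hb', hab', huniq'⟩ := hG'.edge ho
    have hswap : ∀ p ∉ U', ∀ q ∉ U', ∀ x, Equiv.swap p q x ∈ U' ↔ x ∈ U' := by
      intro p hp q hq x
      by_cases h1 : x = p
      · subst h1
        simp [hp, hq]
      by_cases h2 : x = q
      · subst h2
        simp [hp, hq]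
      rw [Equiv.swap_apply_of_ne_of_ne h1 h2]
    obtain ⟨τ, hτ, hτa⟩ : ∃ τ : Equiv.Perm V, (∀ x, τ x ∈ U' ↔ x ∈ U) ∧ τ a = a' := by
      refine ⟨σ.trans (Equiv.swap (σ a) a'), fun x => ?_, by simp⟩
      rw [Equiv.trans_apply, hswap _ (by rwa [hσ]) _ ha', hσ]
    obtain ⟨ρ, hρ, hρa, hρb⟩ : ∃ ρ : Equiv.Perm V, (∀ x, ρ x ∈ U' ↔ x ∈ U) ∧ ρ a = a' ∧
        ρ b = b' := by
      refine ⟨τ.trans (Equiv.swap (τ b) b'), fun x => ?_, ?_, by simp⟩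
      · rw [Equiv.trans_apply, hswap _ (by rwa [hτ]) _ hb', hτ]
      · rw [Equiv.trans_apply, hτa]
        refine Equiv.swap_apply_of_ne_of_ne ?_ hab'.ne
        rw [← hτa]
        exact τ.injective.ne hab.ne
    refine ⟨⟨ρ, fun {x y} => hG.adj_iff hG' ρ hρ (fun x hx y hy => ⟨fun h => ?_, fun h => ?_⟩) x y⟩⟩
    · rcases huniq' _ (by rwa [hρ]) _ (by rwa [hρ]) h with ⟨h1, h2⟩ | ⟨h1, h2⟩
      · rw [← hρa] at h1
        rw [← hρb] at h2
        rw [ρ.injective h1, ρ.injective h2]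
        exact hab
      · rw [← hρb] at h1
        rw [← hρa] at h2
        rw [ρ.injective h1, ρ.injective h2]
        exact hab.symm
    · rcases huniq x hx y hy h with ⟨rfl, rfl⟩ | ⟨rfl, rfl⟩
      · rw [hρa, hρb]
        exact hab'
      · rw [hρa, hρb]
        exact hab'.symm
  · refine ⟨⟨σ, fun {x y} => hG.adj_iff hG' σ hσ (fun x hx y hy => ?_) x y⟩⟩
    exact iff_of_false (hG'.independent ho _ (by rwa [hσ]) _ (by rwa [hσ]))
      (hG.independent ho x hx y hy)

end IsExtremalStructure

/-! ### Upper bound and uniqueness -/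

theorem two_mul_card_edgeFinset [Fintype V] (G : SimpleGraph V) [DecidableRel G.Adj] :
    2 * #G.edgeFinset = adjCount G univ univ := by
  rw [← G.sum_degrees_eq_twice_card_edges, adjCount]
  refine sum_congr rfl fun x _ => ?_
  rw [← card_neighborFinset_eq_degree]
  congr 1
  ext y
  simp

theorem exists_isExtremalStructure_extremalGraph (hk : 2 ≤ k) (hv : ∀ i, 2 ≤ v i) {n : ℕ}
    (hn : halfSum v + 1 ≤ n) : ∃ U : Finset (Fin n), #U + 1 = halfSum v ∧
      IsExtremalStructure (extremalGraph v n) U (∀ i, Odd (v i)) := by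
  have hs : 2 ≤ halfSum v := hk.trans (le_halfSum hv)
  refine ⟨univ.filter fun x : Fin n => x.val < halfSum v - 1, ?_, ?_, ?_, ?_⟩
  · rw [Fin.card_filter_val_lt]
    omega
  · intro x hx y hxy
    exact ⟨hxy, Or.inl (by simpa using hx)⟩
  · intro ho x hx y hy h
    simp only [mem_filter, mem_univ, true_and] at hx hy
    rcases h.2 with h | h | h
    exacts [hx h, hy h, ho h.1]
  · intro ho
    refine ⟨⟨halfSum v - 1, by omega⟩, by simp, ⟨halfSum v, by omega⟩, by simp, ?_, ?_⟩
    · refine ⟨?_, Or.inr (Or.inr ⟨ho, Or.inl ⟨rfl, rfl⟩⟩)⟩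
      simp only [ne_eq, Fin.mk.injEq]
      omega
    · intro x hx y hy h
      simp only [mem_filter, mem_univ, true_and] at hx hy
      rcases h.2 with h | h | h
      · exact absurd h hx
      · exact absurd h hy
      · simpa only [Fin.ext_iff] using h.2

/-- Assuming only at least as many edges yields the upper bound and uniqueness at once. -/
theorem exists_forall_iso_extremalGraph (hk : 2 ≤ k) (hv : ∀ i, 2 ≤ v i) (h3 : ∃ i, v i ≠ 3)
    (hF : IsLinearForest F v) : ∃ N, ∀ n, N ≤ n → ∀ G : SimpleGraph (Fin n), F.Free G →
      adjCount (extremalGraph v n) univ univ ≤ adjCount G univ univ →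
        Nonempty (G ≃g extremalGraph v n) := by
  -- The last argument absorbs the deficit `2 * (s - 1) ^ 2` of `2 * (s - 1) * (n - s + 1)` against
  -- `2 * (s - 1) * n`.
  obtain ⟨N, hN⟩ := exists_isRich_of_free.{0} hk hv hF le_rfl (2 * (halfSum v * halfSum v))
  refine ⟨N + halfSum v + 1, fun n hn G hG hcard => ?_⟩
  obtain ⟨U₀, hU₀, hS₀⟩ := exists_isExtremalStructure_extremalGraph hk hv (n := n) (by omega)
  rw [hS₀.adjCount_univ] at hcard
  have hn' : Fintype.card (Fin n) = n := Fintype.card_fin n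
  obtain ⟨U, hU, hR⟩ := hN (Fin n) G (by omega) hG (by
    rw [hn']
    obtain ⟨r, hr⟩ : ∃ r, n = #U₀ + r := ⟨n - #U₀, by omega⟩
    have h1 : 2 * #U₀ * r ≤ adjCount G univ univ := by
      rw [show Fintype.card (Fin n) - #U₀ = r by omega] at hcard
      omega
    rw [← hU₀]
    nlinarith)
  have hUU : #U = #U₀ := by omega
  rw [← hUU] at hcard
  exact (isExtremalStructure_of_free hk hv hF le_rfl hU hR hG h3
    (by convert hcard)).nonempty_iso hS₀ hUU

end LinearForest

theorem mainTheorem1 {W : Type*} (F : SimpleGraph W) (k : ℕ) (v : Fin k → ℕ)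
    (hk : 2 ≤ k) (hv : ∀ i, 2 ≤ v i) (h3 : ∃ i, v i ≠ 3)
    (hF : LinearForest.IsLinearForest F v) :
    ∃ N : ℕ, ∀ n : ℕ, N ≤ n →
      (SimpleGraph.extremalNumber n F : ℤ) =
          ((LinearForest.halfSum v : ℤ) - 1) * ((n : ℤ) - (LinearForest.halfSum v : ℤ) + 1)
            + ((LinearForest.halfSum v - 1).choose 2 : ℤ)
            + (if ∀ i, Odd (v i) then 1 else 0) ∧
      ∀ (G : SimpleGraph (Fin n)) [DecidableRel G.Adj],
        G.IsExtremal (SimpleGraph.Free F) ↔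
          Nonempty (G ≃g LinearForest.extremalGraph v n) := by
  classical
  obtain ⟨N, hN⟩ := LinearForest.exists_forall_iso_extremalGraph hk hv h3 hF
  refine ⟨N + LinearForest.halfSum v + 1, fun n hn => ?_⟩
  obtain ⟨U, hU, hS⟩ := LinearForest.exists_isExtremalStructure_extremalGraph hk hv (n := n) (by omega)
  have hfree : F.Free (LinearForest.extremalGraph v n) := hS.free hF (by omega)
  have hex : SimpleGraph.extremalNumber n F = (LinearForest.extremalGraph v n).edgeFinset.card := by
    have h1 := SimpleGraph.card_edgeFinset_le_extremalNumber hfree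
    have h2 := (SimpleGraph.extremalNumber_le_iff (V := Fin n) F
      (LinearForest.extremalGraph v n).edgeFinset.card).2 fun G _ hG => by
        by_contra! hlt
        obtain ⟨e⟩ := hN n (by omega) G hG (by
          rw [← LinearForest.two_mul_card_edgeFinset, ← LinearForest.two_mul_card_edgeFinset]
          omega)
        exact hlt.ne e.card_edgeFinset_eq.symm
    rw [Fintype.card_fin] at h1 h2
    exact le_antisymm h2 h1
  refine ⟨?_, fun G _ => ?_⟩
  · have h1 := LinearForest.two_mul_card_edgeFinset (LinearForest.extremalGraph v n)
    rw [hS.adjCount_univ, ← hex] at h1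
    obtain ⟨r, hr⟩ : ∃ r, n = U.card + r := ⟨n - U.card, by omega⟩
    have hr' : (n : ℤ) = U.card + r := by exact_mod_cast hr
    rw [Fintype.card_fin, show n - U.card = r by omega] at h1
    have h2 : 2 * (U.card.choose 2) = U.card * (U.card - 1) := by
      rw [Nat.choose_two_right]
      exact Nat.mul_div_cancel' (Nat.even_mul_pred_self _).two_dvd
    rw [← h2] at h1
    rw [← hU, Nat.add_sub_cancel, hr']
    zify at h1
    push_cast
    split_ifs at h1 ⊢ <;> linarith
  · rw [SimpleGraph.isExtremal_free_iff, Fintype.card_fin, hex]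
    constructor
    · rintro ⟨hG, hcard⟩
      refine hN n (by omega) G hG ?_
      rw [← LinearForest.two_mul_card_edgeFinset, ← LinearForest.two_mul_card_edgeFinset, hcard]
    · rintro ⟨e⟩
      exact ⟨(SimpleGraph.free_congr_right e).2 hfree, e.card_edgeFinset_eq⟩
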